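/- Let $K$ be a field of characteristic zero. A packed word is a word $u=u_1\cdots u_n$ over $\{1,2,\dots\}$ whose set of letters is $\{1,\dots,k\}$ for some $k\ge 0$, i.e. a surjection $u:[n]\to[k]$; $\mathrm{pack}(w)$ denotes the packed word obtained from a word $w$ over an ordered alphabet by replacing its letters $b_1<\dots<b_k$ by $1<\dots<k$. Let $\widehat{\mathbf{WQSym}}$ be the completion, with respect to word length, of the algebra with basis $\mathbf M_u$ ($u$ packed) and product $\mathbf M_u\mathbf M_v=\sum \mathbf M_w$, the sum being over packed words $w=u'v'$ with $\mathrm{pack}(u')=u$, $\mathrm{pack}(v')=v$. Put $I=\sum_{n\ge 0}\mathbf M_{12\cdots n}$ and $$e_1=\log(I)=\sum_{n\ge 1}\frac{(-1)^{n+1}}{n}\,(I-1)^n\in\widehat{\mathbf{WQSym}} .$$ Let $A$ be a commutative, not necessarily unital, $K$-algebra. The quasi-shuffle algebra $QS(A)$ is the vector space $\bigoplus_{n\ge 0}A^{\otimes n}$ ($A^{\otimes 0}=K$) with the commutative product $\uplus$ having unit $1\in A^{\otimes 0}$ and given recursively by $$(a\otimes x)\uplus(b\otimes y)=a\otimes\bigl(x\uplus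 (b\otimes y)\bigr)+b\otimes\bigl((a\otimes x)\uplus y\bigr)+ab\otimes(x\uplus y)\qquad(a,b\in A,\ x,y \text{ tensors}).$$ Let $QS(A)^+=\bigoplus_{n\ge1}A^{\otimes n}$ be its augmentation ideal and $(QS(A)^+)^2$ the square of this ideal. The completion $\widehat{\mathbf{WQSym}}$ acts linearly on $QS(A)$: for $u$ of length $m$ with largest letter $k$, $(a_1\otimes\dots\otimes a_n)\mathbf M_u=b_1\otimes\dots\otimes b_k$ with $b_i=\prod_{u(j)=i}a_j$ if $m=n$, and $(a_1\otimes\dots\otimes a_n)\mathbf M_u=0$ if $m\neq n$. Theorem. The endomorphism $x\mapsto x\cdot e_1$ of $QS(A)$, again denoted $e_1$, has the following properties. 1. $e_1\circ e_1=e_1$, and the image of $e_1$ is contained in $QS(A)^+$. 2. The kernel of $e_1$ contains $(QS(A)^+)^2$. 3. The endomorphism of the space of indecomposables $QS(A)^+/(QS(A)^+)^2$ induced by $e_1$ is well defined and is the identity. 4. $QS(A)^+=\operatorname{im}(e_1)\oplus (QS(A)^+)^2$, and $e_1$ induces a linear isomorphism $QS(A)^+/(QS(A)^+)^2\to\operatorname{im}(e_1)$,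 whose inverse is the restriction to $\operatorname{im}(e_1)$ of the quotient map $QS(A)^+\to QS(A)^+/(QS(A)^+)^2$. All this is natural in $A$: for every morphism $g:A\to B$ of commutative non-unital $K$-algebras, the linear map $QS(A)\to QS(B)$, $a_1\otimes\dots\otimes a_n\mapsto g(a_1)\otimes\dots\otimes g(a_n)$, commutes with $e_1$. 5. $QS(A)$ is the free commutative algebra on $\operatorname{im}(e_1)$: the algebra morphism from the symmetric algebra $\operatorname{Sym}_K(\operatorname{im}(e_1))$ to $QS(A)$ extending the inclusion of $\operatorname{im}(e_1)$ is an isomorphism. -/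

import Mathlib

open scoped TensorProduct DirectSum

set_option linter.unusedSectionVars false

noncomputable section

namespace QuasiShuffle

/-! ### Packed words -/

/-- The packing of a word over the ordered alphabet `ℕ`: if `b₁ < ⋯ < bᵣ` are the letters occurring
in `w`, each letter `bᵢ` is replaced by its rank `i` (so `1, …, r` are the letters of `pack w`). -/
def pack (w : List ℕ) : List ℕ :=
  w.map fun x => (w.toFinset.filter (fun y => y ≤ x)).card

theorem pack_map_of_lt (w : List ℕ) (g : ℕ → ℕ) (hg : ∀ x ∈ w, ∀ y ∈ w, x < y → g x < g y) :
    pack (w.map g) = pack w := by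
  have hle : ∀ x ∈ w, ∀ y ∈ w, (g x ≤ g y ↔ x ≤ y) := by
    intro x hx y hy
    constructor
    · intro h
      by_contra! hc
      exact absurd (hg y hy x hx hc) (not_lt.mpr h)
    · intro h
      rcases h.lt_or_eq with h | rfl
      · exact (hg x hx y hy h).le
      · exact le_rfl
  have hinj : Set.InjOn g {x | x ∈ w} := fun x hx y hy h =>
    le_antisymm ((hle x hx y hy).1 h.le) ((hle y hy x hx).1 h.ge)
  unfold pack
  rw [List.map_map]
  apply List.map_congr_left
  intro x hx
  have : (w.map g).toFinset.filter (fun y => y ≤ g x)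
      = (w.toFinset.filter (fun y => y ≤ x)).image g := by
    ext z
    simp only [Finset.mem_filter, List.mem_toFinset, List.mem_map, Finset.mem_image]
    constructor
    · rintro ⟨⟨y, hy, rfl⟩, hz⟩
      exact ⟨y, ⟨hy, (hle y hy x hx).1 hz⟩, rfl⟩
    · rintro ⟨y, ⟨hy, hyx⟩, rfl⟩
      exact ⟨⟨y, hy, rfl⟩, (hle y hy x hx).2 hyx⟩
  simp only [Function.comp_apply, this]
  apply Finset.card_image_of_injOn
  intro y hy z hz h
  rw [Finset.mem_coe, Finset.mem_filter, List.mem_toFinset] at hy hz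
  exact hinj hy.1 hz.1 h

theorem rank_lt_rank (w : List ℕ) (x y : ℕ) (hy : y ∈ w) (h : x < y) :
    (w.toFinset.filter (fun z => z ≤ x)).card < (w.toFinset.filter (fun z => z ≤ y)).card := by
  apply Finset.card_lt_card
  refine ⟨fun z hz => ?_, fun hsub => ?_⟩
  · simp only [Finset.mem_filter] at hz ⊢
    exact ⟨hz.1, hz.2.trans h.le⟩
  · have : y ∈ w.toFinset.filter (fun z => z ≤ x) := hsub (by simp [hy])
    simp only [Finset.mem_filter] at this
    omega

theorem pack_pack (w : List ℕ) : pack (pack w) = pack w :=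
  pack_map_of_lt w _ fun _ _ y hy h => rank_lt_rank w _ y hy h

theorem pack_take_pack (w : List ℕ) (i : ℕ) : pack ((pack w).take i) = pack (w.take i) := by
  have h : (pack w).take i = (w.take i).map fun x => (w.toFinset.filter (fun y => y ≤ x)).card :=
    (List.map_take ..).symm
  rw [h]
  exact pack_map_of_lt _ _ fun _ _ y hy h => rank_lt_rank w _ y (List.mem_of_mem_take hy) h

theorem pack_drop_pack (w : List ℕ) (i : ℕ) : pack ((pack w).drop i) = pack (w.drop i) := by
  have h : (pack w).drop i = (w.drop i).map fun x => (w.toFinset.filter (fun y => y ≤ x)).card :=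
    (List.map_drop ..).symm
  rw [h]
  exact pack_map_of_lt _ _ fun _ _ y hy h => rank_lt_rank w _ y (List.mem_of_mem_drop hy) h

@[simp] theorem length_pack (w : List ℕ) : (pack w).length = w.length := by simp [pack]

theorem le_length_of_mem_pack (w : List ℕ) (x : ℕ) (hx : x ∈ pack w) : x ≤ w.length := by
  obtain ⟨y, _, rfl⟩ := List.mem_map.1 hx
  exact (Finset.card_le_card (Finset.filter_subset _ _)).trans (List.toFinset_card_le w)

/-- Packed words: the words equal to their packing. -/
def PackedWord : Type := {w : List ℕ // pack w = w}

namespace PackedWord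

/-- The length of a packed word. -/
def length (u : PackedWord) : ℕ := u.1.length

/-- The packed word `pack w` of a word `w`. -/
def ofList (w : List ℕ) : PackedWord := ⟨pack w, pack_pack w⟩

/-- The largest letter of a packed word (`0` for the empty word). A packed word of length `n` and
largest letter `k` is the same as a surjection `[n] → [k]`. -/
def max (u : PackedWord) : ℕ := u.1.toFinset.sup id

/-- The letter of `u` at the position `j` (positions being counted from `0`). -/
def letter (u : PackedWord) {n : ℕ} (h : u.length = n) (j : Fin n) : ℕ :=
  u.1[(j : ℕ)]'(by have := j.2; simp only [length] at h; omega)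

theorem letter_mem (u : PackedWord) {n : ℕ} (h : u.length = n) (j : Fin n) :
    u.letter h j ∈ u.1 := List.getElem_mem _

theorem one_le_letter (u : PackedWord) {n : ℕ} (h : u.length = n) (j : Fin n) :
    1 ≤ u.letter h j := by
  have hm := u.letter_mem h j
  rw [← u.2] at hm
  obtain ⟨y, hy, hy'⟩ := List.mem_map.1 hm
  rw [← hy']
  exact Finset.card_pos.2 ⟨y, by simp [hy]⟩

theorem letter_le_max (u : PackedWord) {n : ℕ} (h : u.length = n) (j : Fin n) :
    u.letter h j ≤ u.max :=
  Finset.le_sup (f := id) (List.mem_toFinset.2 (u.letter_mem h j))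

/-- The packed word `12⋯n`. -/
def identity (n : ℕ) : PackedWord := ofList (List.range' 1 n)

theorem finite_length (n : ℕ) : {u : PackedWord | u.length = n}.Finite := by
  have h : ({l : List (Fin (n + 1)) | l.length = n}).Finite := List.finite_length_eq _ n
  refine Set.Finite.of_injOn (f := fun u => u.1) (t := (List.map Fin.val) '' _)
    ?_ ?_ (h.image _)
  · intro u hu
    have hu' : u.1.length = n := hu
    have hlt : ∀ x ∈ u.1, x < n + 1 := fun x hx => by
      have := le_length_of_mem_pack u.1 x (by rw [u.2]; exact hx)
      omega
    refine ⟨u.1.pmap (fun x hx => ⟨x, hx⟩) hlt, by simpa using hu', ?_⟩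
    simp [List.map_pmap]
  · intro u _ v _ h
    exact Subtype.ext h

/-- The finite set of packed words of length `n`. -/
def ofLength (n : ℕ) : Finset PackedWord := (finite_length n).toFinset

instance (n : ℕ) : Fintype {u : PackedWord // u.length = n} := (finite_length n).fintype

@[simp] theorem mem_ofLength (n : ℕ) (u : PackedWord) : u ∈ ofLength n ↔ u.length = n := by
  simp [ofLength]

end PackedWord

/-! ### The completed algebra of word quasi-symmetric functions -/

/-- The completion of `WQSym` over `K` for the grading by word length. `WQSym` has the basis
`M_u = ∑_{pack w = u} w` (`u` a packed word), and there are finitely many packed words of each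
length, so an element of the completion is an arbitrary family of coefficients: `f` stands for the
series `∑ᵤ f(u) M_u`. -/
def WQSymHat (K : Type*) : Type _ := PackedWord → K

namespace WQSymHat

variable (K : Type*) [Field K]

instance : AddCommGroup (WQSymHat K) := inferInstanceAs (AddCommGroup (PackedWord → K))

instance : Module K (WQSymHat K) := inferInstanceAs (Module K (PackedWord → K))

variable {K}

@[ext] theorem ext {K : Type*} {f g : WQSymHat K} (h : ∀ u, f u = g u) : f = g := funext h

@[simp] theorem add_apply (f g : WQSymHat K) (u : PackedWord) : (f + g) u = f u + g u := rfl

@[simp] theorem zero_apply (u : PackedWord) : (0 : WQSymHat K) u = 0 := rfl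

@[simp] theorem neg_apply (f : WQSymHat K) (u : PackedWord) : (-f) u = - f u := rfl

open scoped Classical in
/-- The basis element `M_u`. -/
def M (u : PackedWord) : WQSymHat K := fun w => if w = u then 1 else 0

/-- The outer product (induced by the concatenation of words), characterized by
`M_u M_v = ∑ M_w`, the sum being over the packed words `w = u'v'` with `pack u' = u` and
`pack v' = v` (see `M_mul_M`), and extended to series. -/
def mul (f g : WQSymHat K) : WQSymHat K := fun w =>
  ∑ i ∈ Finset.range (w.length + 1),
    f (PackedWord.ofList (w.1.take i)) * g (PackedWord.ofList (w.1.drop i))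

instance : Mul (WQSymHat K) := ⟨mul⟩

instance : One (WQSymHat K) := ⟨M (PackedWord.ofList [])⟩

theorem mul_apply (f g : WQSymHat K) (w : PackedWord) :
    (f * g) w = ∑ i ∈ Finset.range (w.length + 1),
      f (PackedWord.ofList (w.1.take i)) * g (PackedWord.ofList (w.1.drop i)) := rfl

theorem ofList_val (u : PackedWord) : PackedWord.ofList u.1 = u := Subtype.ext u.2

theorem ofList_eq_nil_iff (w : List ℕ) :
    PackedWord.ofList w = PackedWord.ofList [] ↔ w = [] := by
  constructor
  · intro h
    have : (pack w).length = (pack []).length := congrArg (fun u => u.1.length) h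
    simpa using this
  · rintro rfl; rfl

theorem one_apply (u : PackedWord) [Decidable (u = PackedWord.ofList [])] :
    (1 : WQSymHat K) u = if u = PackedWord.ofList [] then 1 else 0 := by
  change M _ u = _
  unfold M
  congr

theorem mul_assoc' (f g h : WQSymHat K) : f * g * h = f * (g * h) := by
  ext w
  simp only [mul_apply, PackedWord.length]
  have e1 : ∀ i ∈ Finset.range (w.1.length + 1),
      (∑ j ∈ Finset.range ((PackedWord.ofList (w.1.take i)).1.length + 1),
        f (PackedWord.ofList ((PackedWord.ofList (w.1.take i)).1.take j)) *
        g (PackedWord.ofList ((PackedWord.ofList (w.1.take i)).1.drop j))) *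
        h (PackedWord.ofList (w.1.drop i))
      = ∑ j ∈ Finset.range (i + 1), f (PackedWord.ofList (w.1.take j)) *
          g (PackedWord.ofList ((w.1.take i).drop j)) * h (PackedWord.ofList (w.1.drop i)) := by
    intro i hi
    have hi' : i ≤ w.1.length := by simpa [Nat.lt_succ_iff] using hi
    have hlen : (PackedWord.ofList (w.1.take i)).1.length = i := by
      simp [PackedWord.ofList, hi']
    rw [hlen, Finset.sum_mul]
    refine Finset.sum_congr rfl fun j hj => ?_
    have hj' : j ≤ i := by simpa [Nat.lt_succ_iff] using hj
    congr 3
    · apply Subtype.ext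
      simp only [PackedWord.ofList]
      rw [pack_take_pack, List.take_take, min_eq_left hj']
    · apply Subtype.ext
      simp only [PackedWord.ofList]
      rw [pack_drop_pack]
  have e2 : ∀ j ∈ Finset.range (w.1.length + 1),
      f (PackedWord.ofList (w.1.take j)) *
      (∑ i ∈ Finset.range ((PackedWord.ofList (w.1.drop j)).1.length + 1),
        g (PackedWord.ofList ((PackedWord.ofList (w.1.drop j)).1.take i)) *
        h (PackedWord.ofList ((PackedWord.ofList (w.1.drop j)).1.drop i)))
      = ∑ i ∈ Finset.range (w.1.length - j + 1), f (PackedWord.ofList (w.1.take j)) *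
          g (PackedWord.ofList ((w.1.drop j).take i)) *
          h (PackedWord.ofList (w.1.drop (j + i))) := by
    intro j hj
    have hlen : (PackedWord.ofList (w.1.drop j)).1.length = w.1.length - j := by
      simp [PackedWord.ofList]
    rw [hlen, Finset.mul_sum]
    refine Finset.sum_congr rfl fun i hi => ?_
    have h1 : PackedWord.ofList ((PackedWord.ofList (w.1.drop j)).1.take i)
        = PackedWord.ofList ((w.1.drop j).take i) := Subtype.ext (pack_take_pack _ _)
    have h2 : PackedWord.ofList ((PackedWord.ofList (w.1.drop j)).1.drop i)
        = PackedWord.ofList (w.1.drop (j + i)) := by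
      apply Subtype.ext
      simp only [PackedWord.ofList]
      rw [pack_drop_pack, List.drop_drop]
    rw [← mul_assoc, h1, h2]
  rw [Finset.sum_congr rfl e1, Finset.sum_congr rfl e2, Finset.sum_sigma', Finset.sum_sigma']
  refine Finset.sum_bij' (fun p _ => ⟨p.2, p.1 - p.2⟩) (fun p _ => ⟨p.1 + p.2, p.1⟩) ?_ ?_ ?_ ?_ ?_
  · rintro ⟨i, j⟩ hp
    simp only [Finset.mem_sigma, Finset.mem_range] at hp ⊢
    omega
  · rintro ⟨j, i⟩ hp
    simp only [Finset.mem_sigma, Finset.mem_range] at hp ⊢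
    omega
  · rintro ⟨i, j⟩ hp
    simp only [Finset.mem_sigma, Finset.mem_range] at hp
    have : j + (i - j) = i := by omega
    simp [this]
  · rintro ⟨j, i⟩ hp
    simp
  · rintro ⟨i, j⟩ hp
    simp only [Finset.mem_sigma, Finset.mem_range] at hp
    have : j + (i - j) = i := by omega
    simp only [this, List.drop_take]

theorem one_mul' (f : WQSymHat K) : 1 * f = f := by
  classical
  ext w
  rw [mul_apply, Finset.sum_eq_single 0]
  · simp [one_apply, ofList_val]
  · intro i hi h0
    have hi' : i < w.1.length + 1 := by simpa [PackedWord.length] using hi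
    rw [one_apply, if_neg, zero_mul]
    rw [ofList_eq_nil_iff]
    intro h
    have := congrArg List.length h
    simp at this
    rcases this with h | h
    · exact h0 h
    · rw [h] at hi'; simp at hi'; omega
  · simp

theorem mul_one' (f : WQSymHat K) : f * 1 = f := by
  classical
  ext w
  rw [mul_apply, Finset.sum_eq_single w.length]
  · simp [one_apply, ofList_val, PackedWord.length]
  · intro i hi h0
    have hi' : i < w.1.length + 1 := by simpa [PackedWord.length] using hi
    rw [one_apply, if_neg, mul_zero]
    rw [ofList_eq_nil_iff]
    intro h
    have := congrArg List.length h
    simp at this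
    simp only [PackedWord.length] at h0
    omega
  · simp

/-- The ring structure of the completion of `WQSym` given by the outer product. -/
instance : Ring (WQSymHat K) where
  __ := (inferInstance : AddCommGroup (WQSymHat K))
  mul_assoc := mul_assoc'
  one_mul := one_mul'
  mul_one := mul_one'
  left_distrib f g h := by
    ext w; simp [mul_apply, mul_add, Finset.sum_add_distrib]
  right_distrib f g h := by
    ext w; simp [mul_apply, add_mul, Finset.sum_add_distrib]
  zero_mul f := by ext w; simp [mul_apply]
  mul_zero f := by ext w; simp [mul_apply]

open scoped Classical in
theorem M_mul_M (u v : PackedWord) :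
    (M u * M v : WQSymHat K) =
      ∑ w ∈ (PackedWord.ofLength (u.length + v.length)).filter (fun w =>
        PackedWord.ofList (w.1.take u.length) = u ∧ PackedWord.ofList (w.1.drop u.length) = v),
        M w := by
  ext w
  have hs : ∀ s : Finset PackedWord, (∑ x ∈ s, (M x : WQSymHat K)) w = if w ∈ s then 1 else 0 := by
    intro s
    induction s using Finset.induction_on with
    | empty => simp
    | insert a s ha ih =>
      rw [Finset.sum_insert ha, add_apply, ih]
      by_cases h : w = a
      · subst h; simp [M, ha]
      · simp [M, h]
  rw [hs, mul_apply]
  simp only [M, Finset.mem_filter, PackedWord.mem_ofLength, ← ite_and, mul_ite, mul_one, mul_zero]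
  have hl : ∀ x : List ℕ, (PackedWord.ofList x).length = x.length := fun x => by
    simp [PackedWord.ofList, PackedWord.length]
  by_cases h : w.length = u.length + v.length ∧
      PackedWord.ofList (w.1.take u.length) = u ∧ PackedWord.ofList (w.1.drop u.length) = v
  · rw [if_pos h, Finset.sum_eq_single u.length]
    · rw [if_pos ⟨h.2.2, h.2.1⟩]
    · intro i hi hne
      rw [if_neg]
      rintro ⟨-, h2⟩
      have := congrArg PackedWord.length h2
      rw [hl] at this
      simp only [Finset.mem_range, PackedWord.length, List.length_take] at *
      omega
    · intro hc
      exfalso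
      apply hc
      simp only [Finset.mem_range]
      omega
  · rw [if_neg h]
    apply Finset.sum_eq_zero
    intro i hi
    rw [if_neg]
    rintro ⟨h1, h2⟩
    apply h
    have h1' := congrArg PackedWord.length h1
    have h2' := congrArg PackedWord.length h2
    rw [hl] at h1' h2'
    have hiu : i = u.length := by
      simp only [Finset.mem_range, PackedWord.length, List.length_take] at *
      omega
    subst hiu
    refine ⟨?_, h2, h1⟩
    simp only [Finset.mem_range, PackedWord.length, List.length_drop] at *
    omega

/-- A series `f` without constant term is topologically nilpotent: `fⁿ` has no term of length
less than `n`. -/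
theorem pow_apply_eq_zero (f : WQSymHat K) (hf : f (PackedWord.ofList []) = 0) (n : ℕ)
    (w : PackedWord) (hw : w.length < n) : (f ^ n) w = 0 := by
  induction n generalizing w with
  | zero => omega
  | succ n ih =>
    rw [pow_succ', mul_apply]
    apply Finset.sum_eq_zero
    intro i hi
    rcases Nat.eq_zero_or_pos i with rfl | hi0
    · simp [hf]
    · rw [ih, mul_zero]
      simp only [PackedWord.length, PackedWord.ofList, length_pack, List.length_drop,
        Finset.mem_range] at *
      omega

/-- The logarithm `log f = ∑_{n ≥ 1} (-1)ⁿ⁺¹ (f - 1)ⁿ / n` (for the outer product) of a series `f`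
with constant term `1`. Only the terms with `n ≤ |w|` contribute to the coefficient of `M_w`, by
`pow_apply_eq_zero`. -/
def log (f : WQSymHat K) : WQSymHat K := fun w =>
  ∑ n ∈ Finset.Icc 1 w.length, ((-1) ^ (n + 1) / (n : K)) * ((f - 1) ^ n) w

variable (K)

open scoped Classical in
/-- The element `I = ∑_{n ≥ 0} M_{12⋯n}`. -/
def I : WQSymHat K := fun w => if w = PackedWord.identity w.length then 1 else 0

/-- The generalized (or quasi-) Eulerian idempotent `e₁ = log I`. -/
def e₁ : WQSymHat K := log (I K)

end WQSymHat

/-! ### The quasi-shuffle product on the tensor module -/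

section Product

variable (K : Type*) (A : Type*) [Field K] [NonUnitalCommRing A] [Module K A]
  [IsScalarTower K A A] [SMulCommClass K A A]

open TensorAlgebra (ι)

variable {K A}

/-- Induction on tensors by adding a letter on the left. -/
theorem tensor_induction {C : TensorAlgebra K A → Prop} (one : C 1)
    (cons : ∀ a x, C x → C (ι K a * x)) (add : ∀ x y, C x → C y → C (x + y))
    (smul : ∀ (r : K) x, C x → C (r • x)) (x : TensorAlgebra K A) : C x := by
  suffices h : ∀ x y : TensorAlgebra K A, C y → C (x * y) by simpa using h x 1 one
  intro x
  induction x using TensorAlgebra.induction with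
  | algebraMap r => intro y hy; rw [← Algebra.smul_def]; exact smul r y hy
  | ι a => exact cons a
  | mul x y hx hy => intro z hz; rw [mul_assoc]; exact hx _ (hy _ hz)
  | add x y hx hy => intro z hz; rw [add_mul]; exact add _ _ (hx _ hz) (hy _ hz)

/-- One step of the recursion defining `insertStep`: it sends `(y, z)` to
`(b ⊗ y, a ⊗ φ(b ⊗ y) + b ⊗ z + ab ⊗ φ(y))`. -/
def pairStep (a : A) (φ : TensorAlgebra K A →ₗ[K] TensorAlgebra K A) :
    A →ₗ[K] Module.End K (TensorAlgebra K A × TensorAlgebra K A) :=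
  LinearMap.mk₂ K
    (fun b p => (ι K b * p.1, ι K a * φ (ι K b * p.1) + ι K b * p.2 + ι K (a * b) * φ p.1))
    (fun b b' p => by
      refine Prod.ext ?_ ?_ <;> simp only [map_add, add_mul, mul_add, Prod.mk_add_mk]
      abel)
    (fun c b p => by
      refine Prod.ext ?_ ?_ <;>
        simp only [map_smul, smul_mul_assoc, mul_smul_comm, smul_add, Prod.smul_mk])
    (fun b p q => by
      refine Prod.ext ?_ ?_ <;> simp only [map_add, mul_add, Prod.fst_add, Prod.snd_add]
      abel)
    (fun c b p => by
      refine Prod.ext ?_ ?_ <;>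
        simp only [map_smul, mul_smul_comm, smul_add, Prod.smul_fst, Prod.smul_snd, Prod.smul_mk])

/-- For `φ = (x ⊎ ·)`, the linear map `insertFun a φ = ((a ⊗ x) ⊎ ·)`. -/
def insertFun (a : A) (φ : TensorAlgebra K A →ₗ[K] TensorAlgebra K A) :
    TensorAlgebra K A →ₗ[K] TensorAlgebra K A :=
  LinearMap.snd K _ _ ∘ₗ
    (LinearMap.applyₗ ((1 : TensorAlgebra K A), ι K a * φ 1)) ∘ₗ
      (TensorAlgebra.lift K (pairStep a φ)).toLinearMap

theorem insertFun_one (a : A) (φ : TensorAlgebra K A →ₗ[K] TensorAlgebra K A) :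
    insertFun a φ 1 = ι K a * φ 1 := by
  simp [insertFun]

theorem lift_pairStep_fst (a : A) (φ : TensorAlgebra K A →ₗ[K] TensorAlgebra K A)
    (x z : TensorAlgebra K A) :
    (TensorAlgebra.lift K (pairStep a φ) x (1, z)).1 = x := by
  induction x using tensor_induction with
  | one => simp
  | cons b x hx =>
    rw [map_mul, TensorAlgebra.lift_ι_apply, Module.End.mul_apply]
    simp only [pairStep, LinearMap.mk₂_apply] at hx ⊢
    rw [hx]
  | add x y hx hy => simp [hx, hy]
  | smul r x hx => simp [hx]

theorem insertFun_cons (a : A) (φ : TensorAlgebra K A →ₗ[K] TensorAlgebra K A) (b : A)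
    (y : TensorAlgebra K A) :
    insertFun a φ (ι K b * y) =
      ι K a * φ (ι K b * y) + ι K b * insertFun a φ y + ι K (a * b) * φ y := by
  have h := lift_pairStep_fst a φ y (ι K a * φ 1)
  simp only [insertFun, LinearMap.comp_apply, AlgHom.toLinearMap_apply, LinearMap.applyₗ_apply_apply,
    map_mul, TensorAlgebra.lift_ι_apply, Module.End.mul_apply, LinearMap.snd_apply]
  simp only [pairStep, LinearMap.mk₂_apply] at h ⊢
  rw [h]

/-- `insertFun` as a bilinear map. -/
def insertStep : A →ₗ[K] Module.End K (TensorAlgebra K A →ₗ[K] TensorAlgebra K A) :=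
  LinearMap.mk₂ K insertFun
    (fun a a' φ => by
      ext y
      induction y using tensor_induction with
      | one => simp [insertFun_one, add_mul]
      | cons b y hy =>
        simp only [LinearMap.add_apply, insertFun_cons, map_add, add_mul] at hy ⊢
        rw [hy, mul_add]; abel
      | add x y hx hy => simp only [map_add, hx, hy]
      | smul r x hx => simp only [map_smul, hx])
    (fun c a φ => by
      ext y
      induction y using tensor_induction with
      | one => simp [insertFun_one]
      | cons b y hy =>
        simp only [LinearMap.smul_apply, insertFun_cons, map_smul, smul_mul_assoc, smul_add]
          at hy ⊢
        rw [hy, mul_smul_comm]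
      | add x y hx hy => simp only [map_add, hx, hy]
      | smul r x hx => simp only [map_smul, hx])
    (fun a φ ψ => by
      ext y
      induction y using tensor_induction with
      | one => simp [insertFun_one, mul_add]
      | cons b y hy =>
        simp only [LinearMap.add_apply, insertFun_cons, mul_add] at hy ⊢
        rw [hy, mul_add]; abel
      | add x y hx hy => simp only [map_add, hx, hy]
      | smul r x hx => simp only [map_smul, hx])
    (fun c a φ => by
      ext y
      induction y using tensor_induction with
      | one => simp [insertFun_one]
      | cons b y hy =>
        simp only [LinearMap.smul_apply, insertFun_cons, mul_smul_comm, smul_add] at hy ⊢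
        rw [hy, mul_smul_comm]
      | add x y hx hy => simp only [map_add, hx, hy]
      | smul r x hx => simp only [map_smul, hx])

/-- The quasi-shuffle product `⊎` on the tensor module `⨁ₙ A^{⊗ n}`, the bilinear map determined by
`qsMul_one_left`, `qsMul_one_right` and `qsMul_cons_cons` below. -/
def qsMul : TensorAlgebra K A →ₗ[K] TensorAlgebra K A →ₗ[K] TensorAlgebra K A :=
  LinearMap.applyₗ (LinearMap.id : TensorAlgebra K A →ₗ[K] TensorAlgebra K A) ∘ₗ
    (TensorAlgebra.lift K insertStep).toLinearMap

theorem qsMul_one_left (y : TensorAlgebra K A) : qsMul 1 y = y := by simp [qsMul]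

theorem qsMul_cons (a : A) (x : TensorAlgebra K A) :
    qsMul (ι K a * x) = insertFun a (qsMul x) := by
  simp [qsMul, insertStep]

theorem qsMul_one_right (x : TensorAlgebra K A) : qsMul x 1 = x := by
  induction x using tensor_induction with
  | one => exact qsMul_one_left 1
  | cons a x hx => rw [qsMul_cons, insertFun_one, hx]
  | add x y hx hy => simp only [map_add, LinearMap.add_apply, hx, hy]
  | smul r x hx => simp only [map_smul, LinearMap.smul_apply, hx]

theorem qsMul_cons_cons (a b : A) (x y : TensorAlgebra K A) :
    qsMul (ι K a * x) (ι K b * y) =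
      ι K a * qsMul x (ι K b * y) + ι K b * qsMul (ι K a * x) y + ι K (a * b) * qsMul x y := by
  rw [qsMul_cons, insertFun_cons]

theorem qsMul_comm (x y : TensorAlgebra K A) : qsMul x y = qsMul y x := by
  induction x using tensor_induction generalizing y with
  | one => rw [qsMul_one_left, qsMul_one_right]
  | cons a x hx =>
    induction y using tensor_induction with
    | one => rw [qsMul_one_left, qsMul_one_right]
    | cons b y hy =>
      rw [qsMul_cons_cons, qsMul_cons_cons, hy, hx, hx, mul_comm a b]; abel
    | add y z hy hz => simp only [map_add, LinearMap.add_apply, hy, hz]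
    | smul r y hy => simp only [map_smul, LinearMap.smul_apply, hy]
  | add x z hx hz => simp only [map_add, LinearMap.add_apply, hx, hz]
  | smul r x hx => simp only [map_smul, LinearMap.smul_apply, hx]

theorem qsMul_assoc (x y z : TensorAlgebra K A) :
    qsMul (qsMul x y) z = qsMul x (qsMul y z) := by
  induction x using tensor_induction generalizing y z with
  | one => simp only [qsMul_one_left]
  | cons a x hx =>
    induction y using tensor_induction generalizing z with
    | one => simp only [qsMul_one_left, qsMul_one_right]
    | cons b y hy =>
      induction z using tensor_induction with
      | one => simp only [qsMul_one_right]
      | cons c z hz =>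
        have h1 := hx (ι K b * y) (ι K c * z)
        have h2 := hx (ι K b * y) z
        have h3 := hx y (ι K c * z)
        have h4 := hx y z
        have h5 := hy (ι K c * z)
        have h6 := hy z
        simp only [qsMul_cons_cons, map_add, LinearMap.add_apply, mul_assoc]
          at h1 h2 h3 h4 h5 h6 hz ⊢
        simp only [h1, h2, h3, h4, h5, h6, ← hz, mul_add]
        abel
      | add y z hy hz => simp only [map_add, hy, hz]
      | smul r y hy => simp only [map_smul, hy]
    | add y z hy hz => simp only [map_add, LinearMap.add_apply, hy, hz]
    | smul r y hy => simp only [map_smul, LinearMap.smul_apply, hy]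
  | add x z hx hz => simp only [map_add, LinearMap.add_apply, hx, hz]
  | smul r x hx => simp only [map_smul, LinearMap.smul_apply, hx]

theorem algebraMapInv_qsMul (x y : TensorAlgebra K A) :
    TensorAlgebra.algebraMapInv (qsMul x y) =
      TensorAlgebra.algebraMapInv x * TensorAlgebra.algebraMapInv y := by
  have hι : ∀ a : A, (TensorAlgebra.algebraMapInv (ι K a) : K) = 0 := fun a => by
    simp [TensorAlgebra.algebraMapInv]
  induction x using tensor_induction with
  | one => simp [qsMul_one_left]
  | cons a x hx =>
    clear hx
    induction y using tensor_induction with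
    | one => simp [qsMul_one_right]
    | cons b y hy => simp [qsMul_cons_cons, hι]
    | add y z hy hz => simp only [map_add, hy, hz, mul_add]
    | smul r y hy => simp only [map_smul, hy, mul_smul_comm]
  | add x z hx hz => simp only [map_add, LinearMap.add_apply, hx, hz, add_mul]
  | smul r x hx => simp only [map_smul, LinearMap.smul_apply, hx, smul_mul_assoc]

end Product

/-! ### The quasi-shuffle algebra -/

section Algebra

variable (K : Type*) (A : Type*) [Field K] [NonUnitalCommRing A] [Module K A]
  [IsScalarTower K A A] [SMulCommClass K A A]

/-- The quasi-shuffle algebra `QS(A)`: the tensor module `⨁ₙ A^{⊗ n}` (with `A^{⊗ 0} = K`) equipped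
with the quasi-shuffle product. -/
def QS (K : Type*) (A : Type*) [Field K] [NonUnitalCommRing A] [Module K A] : Type _ :=
  TensorAlgebra K A

instance : AddCommGroup (QS K A) := inferInstanceAs (AddCommGroup (TensorAlgebra K A))

instance : Module K (QS K A) := inferInstanceAs (Module K (TensorAlgebra K A))

/-- The identity, from the tensor module to `QS(A)`. -/
def QS.ofTensor : TensorAlgebra K A ≃ₗ[K] QS K A := LinearEquiv.refl K (TensorAlgebra K A)

variable {K A}

instance : Mul (QS K A) :=
  ⟨fun x y => QS.ofTensor K A (qsMul ((QS.ofTensor K A).symm x) ((QS.ofTensor K A).symm y))⟩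

instance : One (QS K A) := ⟨QS.ofTensor K A 1⟩

theorem QS.ofTensor_mul (x y : TensorAlgebra K A) :
    QS.ofTensor K A x * QS.ofTensor K A y = QS.ofTensor K A (qsMul x y) := rfl

theorem QS.ofTensor_one : QS.ofTensor K A 1 = 1 := rfl

theorem QS.symm_mul (x y : QS K A) : (QS.ofTensor K A).symm (x * y) =
    qsMul ((QS.ofTensor K A).symm x) ((QS.ofTensor K A).symm y) := rfl

theorem QS.symm_one : (QS.ofTensor K A).symm 1 = 1 := rfl

theorem QS.ext {x y : QS K A} (h : (QS.ofTensor K A).symm x = (QS.ofTensor K A).symm y) : x = y :=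
  (QS.ofTensor K A).symm.injective h

/-- The commutative ring structure of `QS(A)`, with the quasi-shuffle product. -/
instance : CommRing (QS K A) where
  __ := (inferInstance : AddCommGroup (QS K A))
  mul_assoc x y z := QS.ext (by simp only [QS.symm_mul, qsMul_assoc])
  one_mul x := QS.ext (by simp only [QS.symm_mul, QS.symm_one, qsMul_one_left])
  mul_one x := QS.ext (by simp only [QS.symm_mul, QS.symm_one, qsMul_one_right])
  left_distrib x y z := QS.ext (by simp only [QS.symm_mul, map_add])
  right_distrib x y z := QS.ext (by simp only [QS.symm_mul, map_add, LinearMap.add_apply])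
  zero_mul x := QS.ext (by simp only [QS.symm_mul, map_zero, LinearMap.zero_apply])
  mul_zero x := QS.ext (by simp only [QS.symm_mul, map_zero])
  mul_comm x y := QS.ext (by simp only [QS.symm_mul, qsMul_comm])

instance : Algebra K (QS K A) :=
  Algebra.ofModule
    (fun r x y => QS.ext (by simp only [QS.symm_mul, map_smul, LinearMap.smul_apply]))
    (fun r x y => QS.ext (by simp only [QS.symm_mul, map_smul]))

variable (K A)

/-- The augmentation `ε : QS(A) → K`, the projection onto `A^{⊗ 0} = K`. -/
def QS.augmentation : QS K A →ₐ[K] K :=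
  AlgHom.ofLinearMap
    (TensorAlgebra.algebraMapInv.toLinearMap ∘ₗ (QS.ofTensor K A).symm.toLinearMap)
    (by simp [QS.symm_one])
    (fun x y => by simp [QS.symm_mul, algebraMapInv_qsMul])

/-- The augmentation ideal `QS(A)⁺ = ⨁_{n ≥ 1} A^{⊗ n}`. -/
def QS.augIdeal : Ideal (QS K A) := RingHom.ker (QS.augmentation K A)

/-- `QS(A)⁺` as a vector space. -/
def QS.plus : Submodule K (QS K A) := (QS.augIdeal K A).restrictScalars K

/-- `(QS(A)⁺)²`, the square of the augmentation ideal, as a vector space. -/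
def QS.plusSq : Submodule K (QS K A) := (QS.augIdeal K A ^ 2).restrictScalars K

/-- `(QS(A)⁺)²` as a subspace of `QS(A)⁺`. -/
abbrev QS.decomposables : Submodule K (QS.plus K A) :=
  (QS.plusSq K A).submoduleOf (QS.plus K A)

/-- The indecomposables `QS(A)⁺ / (QS(A)⁺)²`. -/
abbrev QS.Indecomposables : Type _ := QS.plus K A ⧸ QS.decomposables K A

/-! ### The right action of word quasi-symmetric functions on `QS(A)` -/

variable {K A}

open scoped Classical in
/-- For a packed word `u` of length `n` and `a₁, …, aₙ ∈ A`, the product `∏_{u(j) = i} a_j` over the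
positions of the letter `i` in `u`. The product is taken in the unitization `K ⊕ A` and its
component in `A` is extracted; for a letter `i` that occurs in `u` the product lies in `A`. -/
def blockProd {n : ℕ} (u : PackedWord) (h : u.length = n) (a : Fin n → A) (i : ℕ) : A :=
  (∏ j ∈ Finset.univ.filter (fun j : Fin n => u.letter h j = i),
    (Unitization.inr (a j) : Unitization K A)).snd

theorem blockProd_update_of_ne {n : ℕ} [DecidableEq (Fin n)] (u : PackedWord) (h : u.length = n)
    (a : Fin n → A) (j : Fin n) (x : A) (i : ℕ) (hi : u.letter h j ≠ i) :
    blockProd (K := K) u h (Function.update a j x) i = blockProd (K := K) u h a i := by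
  classical
  unfold blockProd
  refine congrArg (fun z : Unitization K A => z.snd) (Finset.prod_congr rfl fun k hk => ?_)
  rw [Function.update_of_ne]
  rintro rfl
  exact hi (Finset.mem_filter.1 hk).2

open scoped Classical in
theorem blockProd_update_self {n : ℕ} [DecidableEq (Fin n)] (u : PackedWord) (h : u.length = n)
    (a : Fin n → A) (j : Fin n) (x : A) :
    blockProd (K := K) u h (Function.update a j x) (u.letter h j) =
      ((Unitization.inr x : Unitization K A) *
        ∏ k ∈ (Finset.univ.filter (fun k : Fin n => u.letter h k = u.letter h j)).erase j,
          (Unitization.inr (a k) : Unitization K A)).snd := by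
  unfold blockProd
  rw [← Finset.mul_prod_erase _ _ (a := j) (by simp), Function.update_self]
  refine congrArg (fun z : Unitization K A => (_ * z).snd) (Finset.prod_congr rfl fun k hk => ?_)
  rw [Function.update_of_ne (Finset.ne_of_mem_erase hk)]

theorem blocks_update {n : ℕ} [DecidableEq (Fin n)] (u : PackedWord) (h : u.length = n)
    (a : Fin n → A) (j : Fin n) (i₀ : Fin u.max) (hi₀ : (i₀ : ℕ) + 1 = u.letter h j) (x : A) :
    (fun i : Fin u.max => blockProd (K := K) u h (Function.update a j x) (i + 1)) =
      Function.update (fun i : Fin u.max => blockProd (K := K) u h a (i + 1)) i₀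
        (blockProd (K := K) u h (Function.update a j x) (u.letter h j)) := by
  funext i
  by_cases hi : i = i₀
  · subst hi
    rw [Function.update_self, hi₀]
  · rw [Function.update_of_ne hi, blockProd_update_of_ne]
    intro hc
    exact hi (Fin.ext (by omega))

/-- The action of `M_u`, for a packed word `u` of length `n` and largest letter `k`, on `A^{⊗ n}`:
`(a₁ ⊗ ⋯ ⊗ aₙ) M_u = b₁ ⊗ ⋯ ⊗ b_k` where `b_i = ∏_{u(j) = i} a_j`. -/
def blockMap {n : ℕ} (u : PackedWord) (h : u.length = n) :
    MultilinearMap K (fun _ : Fin n => A) (TensorAlgebra K A) where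
  toFun a := TensorAlgebra.tprod K A u.max fun i => blockProd (K := K) u h a (i + 1)
  map_update_add' a j x y := by
    have h1 := u.one_le_letter h j
    have h2 := u.letter_le_max h j
    let i₀ : Fin u.max := ⟨u.letter h j - 1, by omega⟩
    have hi₀ : (i₀ : ℕ) + 1 = u.letter h j := by simp only [i₀]; omega
    rw [blocks_update u h a j i₀ hi₀ x, blocks_update u h a j i₀ hi₀ y,
      blocks_update u h a j i₀ hi₀ (x + y), ← MultilinearMap.map_update_add]
    congr 2
    simp only [blockProd_update_self, Unitization.inr_add, add_mul, Unitization.snd_add]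
  map_update_smul' a j c x := by
    have h1 := u.one_le_letter h j
    have h2 := u.letter_le_max h j
    let i₀ : Fin u.max := ⟨u.letter h j - 1, by omega⟩
    have hi₀ : (i₀ : ℕ) + 1 = u.letter h j := by simp only [i₀]; omega
    rw [blocks_update u h a j i₀ hi₀ x, blocks_update u h a j i₀ hi₀ (c • x),
      ← MultilinearMap.map_update_smul]
    congr 2
    simp only [blockProd_update_self, Unitization.inr_smul, smul_mul_assoc, Unitization.snd_smul]

/-- The action of `f = ∑ᵤ f(u) M_u` on `A^{⊗ n}`; the `M_u` with `u` of length `≠ n` act by `0`. -/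
def actTensorPower (f : WQSymHat K) (n : ℕ) : (⨂[K]^n A) →ₗ[K] TensorAlgebra K A :=
  PiTensorProduct.lift (∑ u : {u : PackedWord // u.length = n}, f u.1 • blockMap u.1 u.2)

/-- The (right) action of the completion of `WQSym` on `QS(A)`: `act f x = x · f`. -/
def act (f : WQSymHat K) : QS K A →ₗ[K] QS K A :=
  (QS.ofTensor K A).toLinearMap ∘ₗ
    DirectSum.toModule K ℕ (TensorAlgebra K A) (actTensorPower f) ∘ₗ
      TensorAlgebra.equivDirectSum.toLinearMap ∘ₗ
        (QS.ofTensor K A).symm.toLinearMap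

theorem act_tprod (f : WQSymHat K) {n : ℕ} (a : Fin n → A) :
    act f (QS.ofTensor K A (TensorAlgebra.tprod K A n a)) =
      ∑ u : {u : PackedWord // u.length = n}, f u.1 •
        QS.ofTensor K A (TensorAlgebra.tprod K A u.1.max
          fun i => blockProd (K := K) u.1 u.2 a (i + 1)) := by
  have h : TensorAlgebra.equivDirectSum (TensorAlgebra.tprod K A n a)
      = DirectSum.lof K ℕ (fun n => ⨂[K]^n A) n (PiTensorProduct.tprod K a) :=
    TensorAlgebra.toDirectSum_tensorPower_tprod a
  simp only [act, LinearMap.comp_apply, LinearEquiv.coe_coe, LinearEquiv.symm_apply_apply]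
  erw [h]
  rw [DirectSum.toModule_lof, actTensorPower, PiTensorProduct.lift.tprod, sum_apply,
    map_sum]
  rfl

variable (K A) in
/-- The endomorphism of `QS(A)` given by the action of the quasi-Eulerian idempotent `e₁`. -/
def eulerian : QS K A →ₗ[K] QS K A := act (WQSymHat.e₁ K)

variable {B : Type*} [NonUnitalCommRing B] [Module K B]

/-- The linear map `QS(A) → QS(B)`, `a₁ ⊗ ⋯ ⊗ aₙ ↦ g(a₁) ⊗ ⋯ ⊗ g(aₙ)`, induced by a morphism of
non-unital algebras `g : A → B`. -/
def QS.map (g : A →ₙₐ[K] B) : QS K A →ₗ[K] QS K B :=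
  (QS.ofTensor K B).toLinearMap ∘ₗ
    (TensorAlgebra.lift K (TensorAlgebra.ι K ∘ₗ (g : A →ₗ[K] B))).toLinearMap ∘ₗ
      (QS.ofTensor K A).symm.toLinearMap

end Algebra

end QuasiShuffle

end

/-!
The space `QS(A)` with the quasi-shuffle product and the deconcatenation coproduct is a commutative
bialgebra, and the tensor length filters it in such a way that the reduced coproduct lowers the
degree in both factors. The completion of `WQSym` acts through the convolution algebra of this
bialgebra: the outer product acts as the convolution product and `I = ∑ M_{12⋯n}` as the identity
(`act_mul`, `act_I`). Therefore `e₁ = log I` acts as the convolution logarithm of the identity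
(`eulerian_eq_logId`), and the theorem is the case of `QS(A)` in a structure theorem for connected
commutative bialgebras `H` in characteristic zero.

For such an `H`, put `J = Id - η ∘ ε` and consider the power `Idᵗ = ∑ₖ (t choose k) Jᵏ` with an
indeterminate exponent, a linear map `H → H[t]`. At every natural number `t` it is a morphism of
algebras, because `H` is commutative; hence it is multiplicative (`idPow_mul`). Its linear
coefficient is `e₁ = log(Id)`, so that `e₁` is an `ε`-derivation (`logId_mul`): it vanishes on `1`
and on the square of the augmentation ideal. As `J` is the identity on the augmentation ideal and
the higher powers of `J` take decomposable values there, `e₁ x - x` is decomposable for `x` in that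
ideal (`logId_sub_mem`). The statements on the projection, its kernel and the indecomposables
follow.

Comparing linear terms in `s` in `Idˢ⁺ᵗ = Idˢ * Idᵗ` gives `d/dt Idᵗ = e₁ * Idᵗ`
(`derivative_idPow`), whence `Id = exp(e₁)` (`exists_sum_logId_pow`). Seen with values in
`Sym(im e₁)`, the map `e₁` is again an `ε`-derivation, and its exponential `σ : H → Sym(im e₁)` is a
morphism of algebras by the binomial theorem (`conv_pow_apply_mul`, `expHom`). The composite of
`σ` with the canonical map `π : Sym(im e₁) → H` is `exp(e₁) = Id`; and `σ` is surjective, by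
induction on the filtration. So `π` and `σ` are inverse to each other
(`isSymmetricAlgebra_range_logId`).

That the outer product acts as the convolution product is verified after evaluation. For `N`
letters `j₁, …, j_N : A → R`, the map `a₁ ⊗ ⋯ ⊗ aₙ ↦ ∑_{i₁ < ⋯ < iₙ} j_{i₁}(a₁) ⋯ j_{iₙ}(aₙ)` is a
morphism of algebras on `QS(A)` (`evalHom`). It turns `(a₁ ⊗ ⋯ ⊗ aₙ) · M_u` into the sum of
`j_{w₁}(a₁) ⋯ j_{wₙ}(aₙ)` over all words `w` with `pack w = u` (`evalHom_act_word`), and for such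
sums the product rule is plain concatenation of words. With values in the tensor powers of the
unitization of `A`, these evaluations separate the elements of `QS(A)` (`eq_of_evalHom_slot_eq`).
-/

noncomputable section

namespace ConnectedBialgebra

open Coalgebra WithConv Polynomial

/-! ### Locally finite sums of linear maps -/

section LocallyFinite

variable {K V M : Type*} [Field K] [AddCommGroup V] [Module K V] [AddCommGroup M] [Module K M]

/-- A sequence of linear maps is locally finite if each vector is killed by all but finitely many
of them. -/
def LocallyFinite (f : ℕ → V →ₗ[K] M) : Prop := ∀ x, ∃ N, ∀ k, N ≤ k → f k x = 0

theorem LocallyFinite.finite_support {f : ℕ → V →ₗ[K] M} (hf : LocallyFinite f) (x : V) :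
    (Function.support fun k => f k x).Finite := by
  obtain ⟨N, hN⟩ := hf x
  refine (Set.finite_lt_nat N).subset fun k hk => ?_
  by_contra h
  exact hk (hN k (not_lt.1 h))

/-- The pointwise sum of a locally finite sequence of linear maps. -/
def locSum (f : ℕ → V →ₗ[K] M) (hf : LocallyFinite f) : V →ₗ[K] M where
  toFun x := ∑ᶠ k, f k x
  map_add' x y := by
    simp only [map_add]
    exact finsum_add_distrib (hf.finite_support x) (hf.finite_support y)
  map_smul' c x := by
    simp only [map_smul, RingHom.id_apply]
    exact (smul_finsum _ _).symm

theorem locSum_eq_sum_range {f : ℕ → V →ₗ[K] M} (hf : LocallyFinite f) {x : V} {N : ℕ}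
    (h : ∀ k, N ≤ k → f k x = 0) : locSum f hf x = ∑ k ∈ Finset.range N, f k x := by
  refine finsum_eq_sum_of_support_subset _ fun k hk => ?_
  by_contra hk'
  exact hk (h k (by simpa using hk'))

end LocallyFinite

/-! ### Polynomials with coefficients in an algebra -/

section Poly

/-- Over an algebra over a field of characteristic zero (which need not be a domain), a polynomial
is determined by its values at the natural numbers. -/
theorem eq_of_eval_natCast_eq (K : Type*) {R : Type*} [Field K] [CharZero K] [CommRing R]
    [Algebra K R] {p q : R[X]} (h : ∀ n : ℕ, p.eval (n : R) = q.eval (n : R)) :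
    p = q := by
  rw [← sub_eq_zero]
  have h0 : ∀ n : ℕ, (p - q).eval (n : R) = 0 := fun n => by simp [h n]
  generalize p - q = r at h0
  ext i
  rw [coeff_zero, ← Module.forall_dual_apply_eq_zero_iff K]
  intro φ
  -- a linear functional applied to the coefficients reduces the claim to polynomials over `K`
  let s : K[X] := ∑ k ∈ Finset.range (r.natDegree + 1), monomial k (φ (r.coeff k))
  have hs : s = 0 := by
    refine Polynomial.eq_zero_of_infinite_isRoot _
      ((Set.infinite_range_of_injective (Nat.cast_injective (R := K))).mono ?_)
    rintro _ ⟨n, rfl⟩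
    have h1 := congrArg φ (h0 n)
    rw [eval_eq_sum_range, map_sum, map_zero] at h1
    rw [Set.mem_ofPred_eq, IsRoot.def, eval_finsetSum, ← h1]
    refine Finset.sum_congr rfl fun k _ => ?_
    have : r.coeff k * (n : R) ^ k = ((n : K) ^ k) • r.coeff k := by
      rw [Algebra.smul_def, map_pow, map_natCast, mul_comm]
    rw [this, map_smul, eval_monomial, smul_eq_mul, mul_comm]
  have h2 : s.coeff i = φ (r.coeff i) := by
    simp only [s, finsetSum_coeff, coeff_monomial, Finset.sum_ite_eq', Finset.mem_range]
    split_ifs with hi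
    · rfl
    · rw [coeff_eq_zero_of_natDegree_lt (by omega), map_zero]
  rw [← h2, hs, coeff_zero]

variable (K : Type*) [Field K]

/-- The binomial coefficient `t ↦ (t choose k)` as a polynomial. -/
def binom (k : ℕ) : K[X] := C ((k.factorial : K)⁻¹) * descPochhammer K k

variable [CharZero K]

theorem binom_eval_natCast (k n : ℕ) : (binom K k).eval (n : K) = (n.choose k : K) := by
  have h : (k.factorial : K) ≠ 0 := Nat.cast_ne_zero.2 k.factorial_ne_zero
  rw [binom, eval_mul, eval_C, descPochhammer_eval_eq_descFactorial,
    Nat.descFactorial_eq_factorial_mul_choose, Nat.cast_mul, inv_mul_cancel_left₀ h]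

theorem descPochhammer_eval_neg_one {K : Type*} [Field K] (k : ℕ) :
    (descPochhammer K k).eval (-1) = (-1) ^ k * (k.factorial : K) := by
  induction k with
  | zero => simp
  | succ k ih =>
    rw [descPochhammer_succ_eval, ih, Nat.factorial_succ]
    push_cast
    ring

/-- For `k = 0`, both sides vanish. -/
theorem binom_coeff_one (k : ℕ) : (binom K k).coeff 1 = (-1) ^ (k + 1) / (k : K) := by
  cases k with
  | zero => simp [binom, coeff_one]
  | succ k =>
    have h : (k.factorial : K) ≠ 0 := Nat.cast_ne_zero.2 k.factorial_ne_zero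
    have h' : (k : K) + 1 ≠ 0 := Nat.cast_add_one_ne_zero k
    rw [binom, coeff_C_mul, descPochhammer_succ_left, coeff_X_mul, coeff_zero_eq_eval_zero,
      eval_comp]
    simp only [eval_sub, eval_X, eval_one, zero_sub]
    rw [descPochhammer_eval_neg_one, Nat.factorial_succ]
    push_cast
    field_simp
    ring

end Poly

/-! ### Filtered bialgebras and nilpotency for the convolution product -/

section Filtration

variable {K H R : Type*} [Field K] [CommRing H] [Bialgebra K H] [CommRing R] [Algebra K R]

/-- An exhaustive filtration of a bialgebra that starts with the scalars and is such that the
reduced coproduct `Δ x - x ⊗ 1 - 1 ⊗ x` lowers the filtration degree in both tensor factors. A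
bialgebra with such a filtration is connected. -/
structure IsConnectedFiltration (F : ℕ → Submodule K H) : Prop where
  mono : Monotone F
  exhaustive : ∀ x, ∃ n, x ∈ F n
  zero_le : F 0 ≤ K ∙ (1 : H)
  comul_mem : ∀ n, ∀ x ∈ F (n + 1), comul (R := K) x - x ⊗ₜ[K] 1 - 1 ⊗ₜ[K] x ∈
    LinearMap.range (TensorProduct.mapIncl (F n) (F n))

theorem conv_apply_one (φ ψ : WithConv (H →ₗ[K] R)) : (φ * ψ) 1 = φ 1 * ψ 1 := by
  rw [LinearMap.convMul_apply, Bialgebra.comul_one, Algebra.TensorProduct.one_def,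
    TensorProduct.map_tmul, LinearMap.mul'_apply]

theorem conv_pow_apply_one {φ : WithConv (H →ₗ[K] R)} (hφ : φ 1 = 0) {k : ℕ} (hk : k ≠ 0) :
    (φ ^ k) 1 = 0 := by
  obtain ⟨k, rfl⟩ := Nat.exists_eq_succ_of_ne_zero hk
  rw [pow_succ', conv_apply_one, hφ, zero_mul]

variable {F : ℕ → Submodule K H}

/-- A convolution product of two maps vanishing at `1` only depends, in filtration degree `n + 1`,
on the values of the factors in degree `n`. -/
theorem IsConnectedFiltration.conv_apply_mem (hF : IsConnectedFiltration F)
    {φ ψ : WithConv (H →ₗ[K] R)} (hφ : φ 1 = 0)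
    (hψ : ψ 1 = 0) (P : Submodule K R) {n : ℕ} (h : ∀ u ∈ F n, ∀ v ∈ F n, φ u * ψ v ∈ P)
    {x : H} (hx : x ∈ F (n + 1)) : (φ * ψ) x ∈ P := by
  have h1 : (φ * ψ) x = LinearMap.mul' K R (TensorProduct.map φ.ofConv ψ.ofConv
      (comul (R := K) x - x ⊗ₜ[K] 1 - 1 ⊗ₜ[K] x)) := by
    simp [LinearMap.convMul_apply, hφ, hψ]
  rw [h1]
  obtain ⟨t, ht⟩ := hF.comul_mem n x hx
  rw [← ht]
  clear ht h1
  induction t using TensorProduct.induction_on with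
  | zero => simp
  | tmul u v => simpa using h u u.2 v v.2
  | add s t hs ht => simpa only [map_add] using P.add_mem hs ht

theorem IsConnectedFiltration.conv_pow_apply_eq_zero (hF : IsConnectedFiltration F)
    {φ : WithConv (H →ₗ[K] R)} (hφ : φ 1 = 0)
    {n : ℕ} : ∀ {k : ℕ} {x : H}, x ∈ F n → n < k → (φ ^ k) x = 0 := by
  induction n with
  | zero =>
    intro k x hx hk
    obtain ⟨c, rfl⟩ := Submodule.mem_span_singleton.1 (hF.zero_le hx)
    rw [map_smul, conv_pow_apply_one hφ (by omega), smul_zero]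
  | succ n ih =>
    intro k x hx hk
    obtain ⟨k, rfl⟩ : ∃ l, k = l + 2 := ⟨k - 2, by omega⟩
    rw [pow_succ']
    refine (Submodule.mem_bot K).1 (hF.conv_apply_mem hφ (conv_pow_apply_one hφ (by omega)) ⊥ ?_ hx)
    intro u _ v hv
    rw [ih hv (by omega), mul_zero]
    exact Submodule.zero_mem _

theorem IsConnectedFiltration.locallyFinite_pow (hF : IsConnectedFiltration F)
    {φ : WithConv (H →ₗ[K] R)} (hφ : φ 1 = 0) :
    LocallyFinite fun k => (φ ^ k).ofConv := fun x => by
  obtain ⟨n, hn⟩ := hF.exhaustive x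
  exact ⟨n + 1, fun k hk => hF.conv_pow_apply_eq_zero hφ hn hk⟩

/-- If a map vanishing at `1` sends `F n` into a subalgebra, so do its powers, and the powers of
exponent at least two even send `F (n + 1)` into it. -/
theorem IsConnectedFiltration.conv_pow_apply_mem (hF : IsConnectedFiltration F)
    {φ : WithConv (H →ₗ[K] R)} (hφ : φ 1 = 0)
    (B : Subalgebra K R) {n : ℕ} (hB : ∀ x ∈ F n, φ x ∈ B) (k : ℕ) {x : H} (hx : x ∈ F (n + 1)) :
    (φ ^ (k + 2)) x ∈ B := by
  have key : ∀ k, ∀ x ∈ F n, (φ ^ (k + 1)) x ∈ B := by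
    intro k
    induction k with
    | zero => simpa using hB
    | succ k ih =>
      intro x hx
      rw [pow_succ']
      exact hF.conv_apply_mem hφ (conv_pow_apply_one hφ (by omega)) (Subalgebra.toSubmodule B)
        (fun u hu v hv => B.mul_mem (hB u hu) (ih v hv)) (hF.mono n.le_succ hx)
  rw [pow_succ']
  exact hF.conv_apply_mem hφ (conv_pow_apply_one hφ (by omega)) (Subalgebra.toSubmodule B)
    (fun u hu v hv => B.mul_mem (hB u hu) (key k v hv)) hx

end Filtration

/-! ### The logarithm of the identity -/

section Log

variable {K H : Type*} [Field K] [CharZero K] [CommRing H] [Bialgebra K H]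

variable (K H) in
/-- The difference `Id - η ∘ ε` of the identity and the unit of the convolution algebra. -/
def idSubOne : WithConv (H →ₗ[K] H) := toConv LinearMap.id - 1

theorem idSubOne_apply (x : H) :
    idSubOne K H x = x - algebraMap K H (counit (R := K) x) := by
  simp [idSubOne, LinearMap.convOne_def]

theorem idSubOne_apply_one : idSubOne K H 1 = 0 := by
  simp [idSubOne_apply]

/-- The convolution powers of the identity of a commutative bialgebra are morphisms of algebras. -/
theorem id_conv_pow_mul (n : ℕ) (x y : H) :
    ((toConv LinearMap.id : WithConv (H →ₗ[K] H)) ^ n) (x * y) =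
      ((toConv LinearMap.id : WithConv (H →ₗ[K] H)) ^ n) x *
        ((toConv LinearMap.id : WithConv (H →ₗ[K] H)) ^ n) y := by
  have h := AlgHom.toLinearMap_convPow (toConv (AlgHom.id K H)) n
  rw [ofConv_toConv, AlgHom.toLinearMap_id] at h
  rw [← h]
  exact map_mul ((toConv (AlgHom.id K H)) ^ n).ofConv x y

variable {F : ℕ → Submodule K H}

theorem locallyFinite_log (hF : IsConnectedFiltration F) :
    LocallyFinite fun k => ((-1) ^ (k + 1) / (k : K)) • (idSubOne K H ^ k).ofConv := fun x => by
  obtain ⟨N, hN⟩ := hF.locallyFinite_pow idSubOne_apply_one x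
  exact ⟨N, fun k hk => by rw [LinearMap.smul_apply, hN k hk, smul_zero]⟩

/-- The logarithm `∑ₖ (-1)ᵏ⁺¹ Jᵏ / k` of the identity for the convolution product, where
`J = Id - η ∘ ε`. The term with `k = 0` has the coefficient `-1 / 0 = 0`. -/
def logId (hF : IsConnectedFiltration F) : H →ₗ[K] H :=
  locSum _ (locallyFinite_log hF)

theorem logId_eq_sum_range (hF : IsConnectedFiltration F) {x : H} {N : ℕ}
    (hN : ∀ k, N ≤ k → (idSubOne K H ^ k) x = 0) :
    logId hF x = ∑ k ∈ Finset.range N, ((-1) ^ (k + 1) / (k : K)) • (idSubOne K H ^ k) x :=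
  locSum_eq_sum_range _ fun k hk => by rw [LinearMap.smul_apply, hN k hk, smul_zero]

theorem locallyFinite_binom (hF : IsConnectedFiltration F) :
    LocallyFinite fun k => LinearMap.mulLeft K ((binom K k).map (algebraMap K H)) ∘ₗ
      (CAlgHom (R := K) (A := H)).toLinearMap ∘ₗ (idSubOne K H ^ k).ofConv := fun x => by
  obtain ⟨N, hN⟩ := hF.locallyFinite_pow idSubOne_apply_one x
  exact ⟨N, fun k hk => by rw [LinearMap.comp_apply, LinearMap.comp_apply, hN k hk]; simp⟩

/-- The convolution power `Idᵗ = ∑ₖ (t choose k) Jᵏ` of the identity with an indeterminate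
exponent `t`, where `J = Id - η ∘ ε`. -/
def idPow (hF : IsConnectedFiltration F) : H →ₗ[K] H[X] :=
  locSum _ (locallyFinite_binom hF)

theorem exists_idPow_apply (hF : IsConnectedFiltration F) (x : H) :
    ∃ N, (∀ k, N ≤ k → (idSubOne K H ^ k) x = 0) ∧ ∀ M, N ≤ M →
      idPow hF x = ∑ k ∈ Finset.range M,
        (binom K k).map (algebraMap K H) * C ((idSubOne K H ^ k) x) := by
  obtain ⟨N, hN⟩ := hF.locallyFinite_pow idSubOne_apply_one x
  refine ⟨N, hN, fun M hM => locSum_eq_sum_range _ fun k hk => ?_⟩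
  rw [LinearMap.comp_apply, LinearMap.comp_apply, hN k (hM.trans hk)]
  simp

theorem idPow_eval (hF : IsConnectedFiltration F) (x : H) (n : ℕ) :
    (idPow hF x).eval (n : H) = ((toConv LinearMap.id : WithConv (H →ₗ[K] H)) ^ n) x := by
  obtain ⟨N, hN, h⟩ := exists_idPow_apply hF x
  have h1 : (toConv LinearMap.id : WithConv (H →ₗ[K] H)) = idSubOne K H + 1 := by
    simp [idSubOne]
  rw [h (max N (n + 1)) (le_max_left _ _), h1,
    (Commute.one_right _).add_pow, ofConv_sum, LinearMap.sum_apply,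
    eval_finsetSum]
  symm
  have h2 : Finset.range (n + 1) ⊆ Finset.range (max N (n + 1)) := by simp
  refine (Finset.sum_subset h2 fun k _ hk => ?_).trans (Finset.sum_congr rfl fun k _ => ?_)
  · -- the binomial coefficients vanish beyond `n`, the convolution powers of `J` beyond `N`
    rw [Nat.choose_eq_zero_of_lt (by simpa using hk)]
    simp
  · rw [one_pow, mul_one, eval_mul, eval_C, ← map_natCast (algebraMap K H) n, eval_map_algebraMap,
      aeval_algebraMap_apply, coe_aeval_eq_eval, binom_eval_natCast, ← nsmul_eq_mul']
    rw [map_natCast, ← nsmul_eq_mul]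
    rfl

/-- Since the natural convolution powers of the identity are morphisms of algebras and polynomials
are determined by their values at the natural numbers, the power with indeterminate exponent is
multiplicative. -/
theorem idPow_mul (hF : IsConnectedFiltration F) (x y : H) :
    idPow hF (x * y) = idPow hF x * idPow hF y :=
  eq_of_eval_natCast_eq K fun n => by
    rw [eval_mul, idPow_eval, idPow_eval, idPow_eval, id_conv_pow_mul]

theorem idPow_coeff_zero (hF : IsConnectedFiltration F) (x : H) :
    (idPow hF x).coeff 0 = algebraMap K H (counit (R := K) x) := by
  have h := idPow_eval hF x 0
  rwa [Nat.cast_zero, ← coeff_zero_eq_eval_zero, pow_zero, LinearMap.convOne_apply] at h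

theorem idPow_coeff_one (hF : IsConnectedFiltration F) (x : H) :
    (idPow hF x).coeff 1 = logId hF x := by
  obtain ⟨N, hN, h⟩ := exists_idPow_apply hF x
  rw [h N le_rfl, logId_eq_sum_range hF hN, finsetSum_coeff]
  refine Finset.sum_congr rfl fun k _ => ?_
  rw [coeff_mul_C, coeff_map, binom_coeff_one, ← Algebra.smul_def]

/-- The logarithm of the identity is an `ε`-derivation. -/
theorem logId_mul (hF : IsConnectedFiltration F) (x y : H) :
    logId hF (x * y) = counit (R := K) x • logId hF y + counit (R := K) y • logId hF x := by
  rw [← idPow_coeff_one, idPow_mul, mul_coeff_one, idPow_coeff_zero, idPow_coeff_zero,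
    idPow_coeff_one, idPow_coeff_one, ← Algebra.smul_def, mul_comm, ← Algebra.smul_def]

theorem logId_one (hF : IsConnectedFiltration F) : logId hF 1 = 0 := by
  have h := logId_mul hF 1 1
  simpa using h

/-- Comparing linear terms in `s` in `Idˢ⁺ᵗ = Idˢ * Idᵗ` shows that the derivative of `Idᵗ` with
respect to `t` is `log(Id) * Idᵗ`. -/
theorem derivative_idPow (hF : IsConnectedFiltration F) (x : H) :
    derivative (idPow hF x) =
      (toConv ((CAlgHom (R := K) (A := H)).toLinearMap ∘ₗ logId hF) * toConv (idPow hF)) x := by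
  refine eq_of_eval_natCast_eq K fun m => ?_
  have h1 : taylor (m : H) (idPow hF x) =
      (toConv (idPow hF) * toConv ((CAlgHom (R := K) (A := H)).toLinearMap ∘ₗ
        ((toConv LinearMap.id : WithConv (H →ₗ[K] H)) ^ m).ofConv)) x := by
    refine eq_of_eval_natCast_eq K fun n => ?_
    rw [taylor_eval, ← Nat.cast_add, idPow_eval, pow_add, (ℛ K x).convMul_apply,
      (ℛ K x).convMul_apply, eval_finsetSum]
    refine Finset.sum_congr rfl fun i _ => ?_
    simp [idPow_eval]
  -- the derivative at `m` is the linear coefficient of the Taylor expansion there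
  rw [← taylor_coeff_one, h1, (ℛ K x).convMul_apply, (ℛ K x).convMul_apply, eval_finsetSum,
    finsetSum_coeff]
  refine Finset.sum_congr rfl fun i _ => ?_
  simp [idPow_eval, idPow_coeff_one]

/-- The coefficient of `tᵏ` in `Idᵗ` is `log(Id)ᵏ / k!`. -/
theorem idPow_coeff (hF : IsConnectedFiltration F) (k : ℕ) (x : H) :
    (k.factorial : K) • (idPow hF x).coeff k = (toConv (logId hF) ^ k) x := by
  induction k generalizing x with
  | zero => simp [idPow_coeff_zero]
  | succ k ih =>
    have h := congrArg (fun p => coeff p k) (derivative_idPow hF x)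
    simp only [coeff_derivative] at h
    rw [(ℛ K x).convMul_apply, finsetSum_coeff] at h
    rw [pow_succ', (ℛ K x).convMul_apply, Nat.factorial_succ]
    have h2 : (((k + 1) * k.factorial : ℕ) : K) • (idPow hF x).coeff (k + 1) =
        (k.factorial : K) • ((idPow hF x).coeff (k + 1) * ((k : H) + 1)) := by
      simp only [Algebra.smul_def, Nat.cast_mul, map_mul, map_natCast]
      push_cast
      ring
    rw [h2, h, Finset.smul_sum]
    refine Finset.sum_congr rfl fun i _ => ?_
    rw [← ih]
    simp

/-- The identity is the exponential of its logarithm. -/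
theorem exists_sum_logId_pow (hF : IsConnectedFiltration F) (x : H) :
    ∃ N, ∀ M, N ≤ M →
      ∑ k ∈ Finset.range M, (k.factorial : K)⁻¹ • (toConv (logId hF) ^ k) x = x := by
  refine ⟨(idPow hF x).natDegree + 1, fun M hM => ?_⟩
  have h := idPow_eval hF x 1
  rw [pow_one, Nat.cast_one, eval_eq_sum_range' (show _ < M by omega)] at h
  refine Eq.trans (Finset.sum_congr rfl fun k _ => ?_) h
  have hk : (k.factorial : K) ≠ 0 := Nat.cast_ne_zero.2 k.factorial_ne_zero
  rw [← idPow_coeff, inv_smul_smul₀ hk, one_pow, mul_one]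

variable (K H) in
/-- The augmentation ideal of a bialgebra. -/
def augmentationIdeal : Ideal H := RingHom.ker (Bialgebra.counitAlgHom K H)

theorem mem_augmentationIdeal {x : H} :
    x ∈ augmentationIdeal K H ↔ counit (R := K) x = 0 := Iff.rfl

theorem idSubOne_mem (x : H) : idSubOne K H x ∈ augmentationIdeal K H := by
  rw [mem_augmentationIdeal, idSubOne_apply, map_sub, Bialgebra.counit_algebraMap, sub_self]

theorem idSubOne_pow_mem (k : ℕ) (x : H) :
    (idSubOne K H ^ k) x ∈ augmentationIdeal K H ^ k := by
  induction k generalizing x with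
  | zero => simp
  | succ k ih =>
    rw [pow_succ', pow_succ', (ℛ K x).convMul_apply]
    exact Ideal.sum_mem _ fun i _ => Ideal.mul_mem_mul (idSubOne_mem _) (ih _)

/-- On the augmentation ideal, `J` is the identity and the powers `Jᵏ` with `k ≥ 2` take
decomposable values. -/
theorem logId_sub_mem (hF : IsConnectedFiltration F) {x : H}
    (hx : x ∈ augmentationIdeal K H) : logId hF x - x ∈ augmentationIdeal K H ^ 2 := by
  obtain ⟨N, hN⟩ := hF.locallyFinite_pow idSubOne_apply_one x
  rw [logId_eq_sum_range hF (N := N + 2) fun k hk => hN k (by omega),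
    Finset.sum_range_succ', Finset.sum_range_succ']
  have h1 : idSubOne K H x = x := by
    rw [idSubOne_apply, mem_augmentationIdeal.1 hx, map_zero, sub_zero]
  simp only [Nat.cast_zero, div_zero, zero_smul, add_zero, zero_add, pow_one,
    Nat.cast_one, div_one, h1]
  norm_num
  refine Ideal.sum_mem _ fun k _ => Submodule.smul_of_tower_mem _ _ ?_
  exact Ideal.pow_le_pow_right (by omega) (idSubOne_pow_mem (k + 2) x)

theorem logId_mem (hF : IsConnectedFiltration F) (x : H) :
    logId hF x ∈ augmentationIdeal K H := by
  obtain ⟨N, hN⟩ := hF.locallyFinite_pow idSubOne_apply_one x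
  rw [logId_eq_sum_range hF hN]
  refine Ideal.sum_mem _ fun k _ => ?_
  rcases Nat.eq_zero_or_pos k with rfl | hk
  · simp
  · exact Submodule.smul_of_tower_mem _ _ (Ideal.pow_le_self hk.ne' (idSubOne_pow_mem k x))

theorem logId_eq_zero_of_mem_sq (hF : IsConnectedFiltration F) {x : H}
    (hx : x ∈ augmentationIdeal K H ^ 2) : logId hF x = 0 := by
  rw [pow_two] at hx
  refine Submodule.mul_induction_on hx (fun u hu v hv => ?_) fun u v hu hv => ?_
  · rw [logId_mul, mem_augmentationIdeal.1 hu, mem_augmentationIdeal.1 hv]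
    simp
  · rw [map_add, hu, hv, add_zero]

end Log

/-! ### Exponentials of derivations -/

section Exp

variable {K H R : Type*} [Field K] [CharZero K] [CommRing H] [Bialgebra K H] [CommRing R]
  [Algebra K R]

/-- The linear map `x ⊗ y ↦ f x * g y`. -/
def box (f g : WithConv (H →ₗ[K] R)) : WithConv (H ⊗[K] H →ₗ[K] R) :=
  toConv (LinearMap.mul' K R ∘ₗ TensorProduct.map f.ofConv g.ofConv)

theorem box_tmul (f g : WithConv (H →ₗ[K] R)) (x y : H) : box f g (x ⊗ₜ y) = f x * g y := by
  simp [box]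

theorem box_mul_box (f g h k : WithConv (H →ₗ[K] R)) :
    box f g * box h k = box (f * h) (g * k) := by
  have h1 := LinearMap.algHom_comp_convMul_distrib (Algebra.TensorProduct.lmul' K (S := R))
    (toConv (TensorProduct.map f.ofConv g.ofConv)) (toConv (TensorProduct.map h.ofConv k.ofConv))
  rw [TensorProduct.map_convMul_map, Algebra.TensorProduct.lmul'_toLinearMap] at h1
  exact congrArg toConv h1.symm

theorem box_one_one : box (1 : WithConv (H →ₗ[K] R)) 1 = 1 := by
  ext x y
  simp [box, LinearMap.convOne_def, mul_comm]

theorem box_pow (f g : WithConv (H →ₗ[K] R)) (n : ℕ) : box f g ^ n = box (f ^ n) (g ^ n) := by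
  induction n with
  | zero => simp only [pow_zero, box_one_one]
  | succ n ih => rw [pow_succ, ih, box_mul_box, ← pow_succ, ← pow_succ]

theorem conv_pow_comp_mul (f : WithConv (H →ₗ[K] R)) (n : ℕ) :
    (toConv (f.ofConv ∘ₗ LinearMap.mul' K H)) ^ n =
      toConv ((f ^ n).ofConv ∘ₗ LinearMap.mul' K H) := by
  induction n with
  | zero =>
    ext x y
    simp [LinearMap.convOne_def, mul_comm]
  | succ n ih =>
    rw [pow_succ, ih, pow_succ]
    exact congrArg toConv
      (LinearMap.convMul_comp_coalgHom_distrib (f ^ n) f (Bialgebra.mulCoalgHom K H)).symm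

/-- The Leibniz formula for the convolution powers of an `ε`-derivation `δ`: as `δ ∘ μ` is the sum
of the commuting elements `δ ⊠ 1` and `1 ⊠ δ` of the convolution algebra of `H ⊗ H`, this is the
binomial theorem. -/
theorem conv_pow_apply_mul {δ : WithConv (H →ₗ[K] R)}
    (hδ : ∀ x y, δ (x * y) = counit (R := K) x • δ y + counit (R := K) y • δ x) (n : ℕ) (x y : H) :
    (δ ^ n) (x * y) =
      ∑ p ∈ Finset.HasAntidiagonal.antidiagonal n,
        (n.choose p.1 : R) * ((δ ^ p.1) x * (δ ^ p.2) y) := by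
  have h1 : toConv (δ.ofConv ∘ₗ LinearMap.mul' K H) = box δ 1 + box 1 δ := by
    ext x y
    simp [box, hδ, LinearMap.convOne_def, Algebra.smul_def]
    ring
  have h2 : Commute (box δ 1) (box 1 δ) := by
    rw [commute_iff_eq, box_mul_box, box_mul_box, mul_one, one_mul]
  have h3 := conv_pow_comp_mul δ n
  rw [h1, h2.add_pow'] at h3
  have h4 := congrArg (fun f => f (x ⊗ₜ y)) h3
  simp only [LinearMap.comp_apply, LinearMap.mul'_apply] at h4
  rw [← h4, ofConv_sum, LinearMap.sum_apply]
  refine Finset.sum_congr rfl fun p _ => ?_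
  rw [box_pow, box_pow, box_mul_box, one_pow, one_pow, mul_one, one_mul, ← box_tmul, ← nsmul_eq_mul]
  rfl

variable {F : ℕ → Submodule K H}

theorem locallyFinite_exp (hF : IsConnectedFiltration F) {δ : WithConv (H →ₗ[K] R)}
    (hδ : δ 1 = 0) : LocallyFinite fun k => (monomial k).restrictScalars K ∘ₗ
      ((k.factorial : K)⁻¹ • (δ ^ k).ofConv) := fun x => by
  obtain ⟨N, hN⟩ := hF.locallyFinite_pow hδ x
  refine ⟨N, fun k hk => ?_⟩
  rw [LinearMap.comp_apply, LinearMap.smul_apply, hN k hk, smul_zero, map_zero]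

/-- The exponential `exp(tδ) = ∑ₖ δᵏ tᵏ / k!` for the convolution product, with an indeterminate
`t`. -/
def expPoly (hF : IsConnectedFiltration F) {δ : WithConv (H →ₗ[K] R)} (hδ : δ 1 = 0) :
    H →ₗ[K] R[X] :=
  locSum _ (locallyFinite_exp hF hδ)

theorem expPoly_coeff (hF : IsConnectedFiltration F) {δ : WithConv (H →ₗ[K] R)} (hδ : δ 1 = 0)
    (x : H) (k : ℕ) : (expPoly hF hδ x).coeff k = (k.factorial : K)⁻¹ • (δ ^ k) x := by
  obtain ⟨N, hN⟩ := locallyFinite_exp hF hδ x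
  rw [expPoly, locSum_eq_sum_range _ (N := max N (k + 1)) fun l hl => hN l (by omega),
    finsetSum_coeff, Finset.sum_eq_single k]
  · simp
  · intro l _ hl
    simp [coeff_monomial, hl]
  · simp

/-- The exponential of an `ε`-derivation is a morphism of algebras. -/
def expHom (hF : IsConnectedFiltration F) (δ : WithConv (H →ₗ[K] R))
    (hδ : ∀ x y, δ (x * y) = counit (R := K) x • δ y + counit (R := K) y • δ x) : H →ₐ[K] R :=
  have h1 : δ 1 = 0 := by simpa using hδ 1 1
  ((aeval (1 : R)).restrictScalars K).comp <| AlgHom.ofLinearMap (expPoly hF h1)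
    (by
      ext k
      rw [expPoly_coeff, coeff_one]
      rcases eq_or_ne k 0 with rfl | hk
      · simp
      · rw [conv_pow_apply_one h1 hk, smul_zero, if_neg hk])
    (fun x y => by
      ext n
      rw [expPoly_coeff, coeff_mul, conv_pow_apply_mul hδ, Finset.smul_sum]
      refine Finset.sum_congr rfl fun p hp => ?_
      obtain ⟨i, j⟩ := p
      obtain rfl : i + j = n := Finset.HasAntidiagonal.mem_antidiagonal.1 hp
      have hi : (i.factorial : K) ≠ 0 := Nat.cast_ne_zero.2 i.factorial_ne_zero
      have hj : (j.factorial : K) ≠ 0 := Nat.cast_ne_zero.2 j.factorial_ne_zero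
      have hn : ((i + j).factorial : K) ≠ 0 := Nat.cast_ne_zero.2 (Nat.factorial_ne_zero _)
      rw [expPoly_coeff, expPoly_coeff, smul_mul_smul_comm, ← nsmul_eq_mul,
        ← Nat.cast_smul_eq_nsmul K, smul_smul, Nat.cast_add_choose]
      congr 1
      field_simp)

theorem expHom_apply (hF : IsConnectedFiltration F) (δ : WithConv (H →ₗ[K] R))
    (hδ : ∀ x y, δ (x * y) = counit (R := K) x • δ y + counit (R := K) y • δ x) (x : H) :
    ∃ N, ∀ M, N ≤ M →
      expHom hF δ hδ x = ∑ k ∈ Finset.range M, (k.factorial : K)⁻¹ • (δ ^ k) x := by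
  have h1 : δ 1 = 0 := by simpa using hδ 1 1
  refine ⟨(expPoly hF h1 x).natDegree + 1, fun M hM => ?_⟩
  have h : expHom hF δ hδ x = aeval (1 : R) (expPoly hF h1 x) := rfl
  rw [h, coe_aeval_eq_eval, eval_eq_sum_range' (show _ < M by omega)]
  refine Finset.sum_congr rfl fun k _ => ?_
  rw [expPoly_coeff, one_pow, mul_one]

end Exp

/-! ### The structure theorem -/

section Structure

variable {K H : Type*} [Field K] [CharZero K] [CommRing H] [Bialgebra K H]
  {F : ℕ → Submodule K H}

/-- The logarithm of the identity, as a map into the symmetric algebra of its image. -/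
def logSym (hF : IsConnectedFiltration F) :
    WithConv (H →ₗ[K] SymmetricAlgebra K (LinearMap.range (logId hF))) :=
  toConv (SymmetricAlgebra.ι K _ ∘ₗ (logId hF).rangeRestrict)

theorem logSym_mul (hF : IsConnectedFiltration F) (x y : H) :
    logSym hF (x * y) =
      counit (R := K) x • logSym hF y + counit (R := K) y • logSym hF x := by
  have h : (logId hF).rangeRestrict (x * y) = counit (R := K) x • (logId hF).rangeRestrict y +
      counit (R := K) y • (logId hF).rangeRestrict x := Subtype.ext (logId_mul hF x y)
  simp only [logSym, LinearMap.comp_apply, h, map_add, map_smul]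

theorem lift_comp_logSym_pow (hF : IsConnectedFiltration F) (k : ℕ) :
    (SymmetricAlgebra.lift (LinearMap.range (logId hF)).subtype).toLinearMap ∘ₗ
      (logSym hF ^ k).ofConv = (toConv (logId hF) ^ k).ofConv := by
  induction k with
  | zero =>
    ext x
    simp [LinearMap.convOne_def]
  | succ k ih =>
    rw [pow_succ, LinearMap.algHom_comp_convMul_distrib, ih, pow_succ]
    congr 3
    ext x
    simp [logSym]

/-- The inverse of the canonical map `Sym(im log(Id)) → H` is the exponential of `log(Id)`, seen as
a map with values in `Sym(im log(Id))`. -/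
theorem isSymmetricAlgebra_range_logId (hF : IsConnectedFiltration F) :
    IsSymmetricAlgebra (LinearMap.range (logId hF)).subtype := by
  let σ := expHom hF (logSym hF) (logSym_mul hF)
  let π := SymmetricAlgebra.lift (LinearMap.range (logId hF)).subtype
  have h1 : ∀ x, π (σ x) = x := fun x => by
    obtain ⟨N, hN⟩ := expHom_apply hF (logSym hF) (logSym_mul hF) x
    obtain ⟨N', hN'⟩ := exists_sum_logId_pow hF x
    refine Eq.trans ?_ (hN' (max N N') (le_max_right _ _))
    rw [show σ x = _ from hN (max N N') (le_max_left _ _), map_sum]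
    refine Finset.sum_congr rfl fun k _ => ?_
    rw [map_smul, ← lift_comp_logSym_pow]
    rfl
  have h0 : logSym hF 1 = 0 := by simpa using logSym_mul hF 1 1
  -- the generators are in the image of `σ`, by induction on the filtration degree: in `σ x`, all
  -- terms but `logSym hF x` are products of generators coming from a smaller degree
  have h2 : ∀ n, ∀ x ∈ F n, logSym hF x ∈ σ.range := by
    intro n
    induction n with
    | zero =>
      intro x hx
      obtain ⟨c, rfl⟩ := Submodule.mem_span_singleton.1 (hF.zero_le hx)
      rw [map_smul, h0, smul_zero]
      exact zero_mem _
    | succ n ih =>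
      intro x hx
      obtain ⟨N, hN⟩ := expHom_apply hF (logSym hF) (logSym_mul hF) x
      have h := hN (N + 2) (by omega)
      rw [Finset.sum_range_succ', Finset.sum_range_succ', pow_zero, zero_add, pow_one] at h
      simp only [Nat.factorial_one, Nat.factorial_zero, Nat.cast_one, inv_one, one_smul] at h
      have h3 : logSym hF x = σ x - (∑ k ∈ Finset.range N, ((k + 1 + 1).factorial : K)⁻¹ •
          (logSym hF ^ (k + 1 + 1)) x) - (1 : WithConv (H →ₗ[K] _)) x := by
        rw [show σ x = _ from h]
        abel
      rw [h3]
      refine sub_mem (sub_mem (AlgHom.mem_range_self _ _) (sum_mem fun k _ => ?_)) ?_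
      · exact Subalgebra.smul_mem _ (hF.conv_pow_apply_mem h0 _ ih k hx) _
      · rw [LinearMap.convOne_apply]
        exact Subalgebra.algebraMap_mem _ _
  have h4 : ∀ s, s ∈ σ.range := by
    intro s
    induction s using SymmetricAlgebra.induction with
    | algebraMap r => exact Subalgebra.algebraMap_mem _ r
    | ι v =>
      obtain ⟨v, x, rfl⟩ := v
      obtain ⟨n, hn⟩ := hF.exhaustive x
      exact h2 n x hn
    | mul a b ha hb => exact mul_mem ha hb
    | add a b ha hb => exact add_mem ha hb
  refine ⟨fun s t hst => ?_, fun x => ⟨σ x, h1 x⟩⟩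
  obtain ⟨x, rfl⟩ := h4 s
  obtain ⟨y, rfl⟩ := h4 t
  have h5 : π (σ x) = π (σ y) := hst
  rw [h1, h1] at h5
  rw [h5]

end Structure

end ConnectedBialgebra

namespace QuasiShuffle

/-! ### The deconcatenation bialgebra structure of `QS(A)` -/

section Bialgebra

variable {K A : Type*} [Field K] [NonUnitalCommRing A] [Module K A]

/-- The operator `x ↦ a ⊗ x` on `QS(A)`. -/
def QS.cons (a : A) : QS K A →ₗ[K] QS K A :=
  (QS.ofTensor K A).toLinearMap ∘ₗ LinearMap.mulLeft K (TensorAlgebra.ι K a) ∘ₗ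
    (QS.ofTensor K A).symm.toLinearMap

theorem QS.cons_ofTensor (a : A) (x : TensorAlgebra K A) :
    QS.cons a (QS.ofTensor K A x) = QS.ofTensor K A (TensorAlgebra.ι K a * x) := rfl

theorem QS.cons_add (a b : A) (x : QS K A) :
    QS.cons (a + b) x = QS.cons a x + QS.cons b x := by
  simp [QS.cons, add_mul]

theorem QS.cons_smul (r : K) (a : A) (x : QS K A) : QS.cons (r • a) x = r • QS.cons a x := by
  simp [QS.cons]

variable [IsScalarTower K A A] [SMulCommClass K A A]

@[elab_as_elim]
theorem QS.induction {C : QS K A → Prop} (one : C 1) (cons : ∀ a x, C x → C (QS.cons a x))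
    (add : ∀ x y, C x → C y → C (x + y)) (smul : ∀ (r : K) x, C x → C (r • x)) (x : QS K A) :
    C x :=
  tensor_induction (C := fun x => C (QS.ofTensor K A x)) one (fun a _ hx => cons a _ hx)
    (fun _ _ hx hy => add _ _ hx hy) (fun r _ hx => smul r _ hx) ((QS.ofTensor K A).symm x)

variable (K) in
/-- The tensor `a₁ ⊗ ⋯ ⊗ aₙ`, for a list `[a₁, …, aₙ]` of elements of `A`. -/
def QS.word : List A → QS K A
  | [] => 1
  | a :: l => QS.cons a (QS.word l)

theorem QS.ofTensor_tprod {n : ℕ} (c : Fin n → A) :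
    QS.ofTensor K A (TensorAlgebra.tprod K A n c) = QS.word K (List.ofFn c) := by
  rw [TensorAlgebra.tprod_apply]
  induction n with
  | zero => rfl
  | succ n ih =>
    rw [List.ofFn_succ, List.prod_cons, List.ofFn_succ, QS.word, ← ih, QS.cons_ofTensor]

@[elab_as_elim]
theorem QS.word_induction {C : QS K A → Prop} (word : ∀ l, C (QS.word K l))
    (add : ∀ x y, C x → C y → C (x + y)) (smul : ∀ (r : K) x, C x → C (r • x)) (x : QS K A) :
    C x := by
  have h : x ∈ Submodule.span K (Set.range (QS.word (K := K) (A := A))) := by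
    induction x using QS.induction with
    | one => exact Submodule.subset_span ⟨[], rfl⟩
    | cons a x hx =>
      refine (Submodule.map_span_le (QS.cons a) _ _).2 ?_ (Submodule.mem_map_of_mem hx)
      rintro _ ⟨l, rfl⟩
      exact Submodule.subset_span ⟨a :: l, rfl⟩
    | add x y hx hy => exact add_mem hx hy
    | smul r x hx => exact Submodule.smul_mem _ _ hx
  induction h using Submodule.span_induction with
  | mem x hx =>
    obtain ⟨l, rfl⟩ := hx
    exact word l
  | zero => simpa using smul 0 _ (word [])
  | add x y _ _ hx hy => exact add _ _ hx hy
  | smul r x _ hx => exact smul _ _ hx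

theorem QS.cons_mul_cons (a b : A) (x y : QS K A) :
    QS.cons a x * QS.cons b y =
      QS.cons a (x * QS.cons b y) + QS.cons b (QS.cons a x * y) + QS.cons (a * b) (x * y) :=
  congrArg (QS.ofTensor K A) (qsMul_cons_cons a b ((QS.ofTensor K A).symm x)
    ((QS.ofTensor K A).symm y))

theorem QS.augmentation_cons (a : A) (x : QS K A) :
    QS.augmentation K A (QS.cons a x) = 0 := by
  simp [QS.augmentation, QS.cons, TensorAlgebra.algebraMapInv]

/-- One step of the recursion defining the deconcatenation coproduct: it sends `(x, Δ x)` to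
`(a ⊗ x, Δ (a ⊗ x))`. -/
def comulStep : A →ₗ[K] Module.End K (QS K A × QS K A ⊗[K] QS K A) :=
  LinearMap.mk₂ K
    (fun a p => (QS.cons a p.1, 1 ⊗ₜ[K] QS.cons a p.1 + (QS.cons a).rTensor (QS K A) p.2))
    (fun a b p => by
      have h : (QS.cons (a + b) : QS K A →ₗ[K] QS K A) = QS.cons a + QS.cons b :=
        LinearMap.ext (QS.cons_add a b)
      refine Prod.ext ?_ ?_
      · simp [h]
      · simp only [h, LinearMap.add_apply, TensorProduct.tmul_add, LinearMap.rTensor_add,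
          Prod.snd_add]
        abel)
    (fun r a p => by
      have h : (QS.cons (r • a) : QS K A →ₗ[K] QS K A) = r • QS.cons a :=
        LinearMap.ext (QS.cons_smul r a)
      refine Prod.ext ?_ ?_
      · simp [h]
      · simp only [h, LinearMap.smul_apply, TensorProduct.tmul_smul, LinearMap.rTensor_smul,
          Prod.smul_snd, smul_add])
    (fun a p q => by
      refine Prod.ext ?_ ?_
      · simp
      · simp only [Prod.fst_add, Prod.snd_add, map_add, TensorProduct.tmul_add]
        abel)
    (fun r a p => by
      refine Prod.ext ?_ ?_
      · simp
      · simp only [Prod.smul_fst, Prod.smul_snd, map_smul, TensorProduct.tmul_smul, smul_add])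

/-- The deconcatenation coproduct `Δ(a₁ ⊗ ⋯ ⊗ aₙ) = ∑ᵢ (a₁ ⊗ ⋯ ⊗ aᵢ) ⊗ (aᵢ₊₁ ⊗ ⋯ ⊗ aₙ)`,
characterized by `deconc_one` and `deconc_cons`. -/
def deconc : QS K A →ₗ[K] QS K A ⊗[K] QS K A :=
  LinearMap.snd K _ _ ∘ₗ
    (LinearMap.applyₗ ((1 : QS K A), (1 : QS K A) ⊗ₜ[K] (1 : QS K A)) :
      Module.End K (QS K A × QS K A ⊗[K] QS K A) →ₗ[K] QS K A × QS K A ⊗[K] QS K A) ∘ₗ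
      (TensorAlgebra.lift K comulStep).toLinearMap ∘ₗ (QS.ofTensor K A).symm.toLinearMap

theorem deconc_one : deconc (1 : QS K A) = 1 ⊗ₜ[K] 1 := by
  simp [deconc, QS.symm_one]

theorem lift_comulStep_fst (x : QS K A) (t : QS K A ⊗[K] QS K A) :
    (TensorAlgebra.lift K comulStep ((QS.ofTensor K A).symm x) (1, t)).1 = x := by
  induction x using QS.induction with
  | one => simp [QS.symm_one]
  | cons a x hx =>
    have h : (QS.ofTensor K A).symm (QS.cons a x) =
      TensorAlgebra.ι K a * (QS.ofTensor K A).symm x := rfl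
    rw [h, map_mul, TensorAlgebra.lift_ι_apply, Module.End.mul_apply]
    simp only [comulStep, LinearMap.mk₂_apply] at hx ⊢
    rw [hx]
  | add x y hx hy => simp [hx, hy]
  | smul r x hx => simp [hx]

theorem deconc_cons (a : A) (x : QS K A) :
    deconc (QS.cons a x) = 1 ⊗ₜ[K] QS.cons a x + (QS.cons a).rTensor (QS K A) (deconc x) := by
  have h := lift_comulStep_fst x ((1 : QS K A) ⊗ₜ[K] (1 : QS K A))
  have h' : (QS.ofTensor K A).symm (QS.cons a x) =
    TensorAlgebra.ι K a * (QS.ofTensor K A).symm x := rfl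
  simp only [deconc, LinearMap.comp_apply, LinearEquiv.coe_coe, AlgHom.toLinearMap_apply,
    LinearMap.applyₗ_apply_apply, h', map_mul, TensorAlgebra.lift_ι_apply, Module.End.mul_apply,
    LinearMap.snd_apply]
  simp only [comulStep, LinearMap.mk₂_apply] at h ⊢
  rw [h]

theorem deconc_coassoc (x : QS K A) :
    TensorProduct.assoc K (QS K A) (QS K A) (QS K A) (deconc.rTensor (QS K A) (deconc x)) =
      deconc.lTensor (QS K A) (deconc x) := by
  induction x using QS.induction with
  | one => simp [deconc_one]
  | cons a x hx =>
    have h1 : ∀ t : QS K A ⊗[K] QS K A,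
        TensorProduct.assoc K (QS K A) (QS K A) (QS K A)
          (deconc.rTensor (QS K A) ((QS.cons a).rTensor (QS K A) t)) =
        1 ⊗ₜ[K] ((QS.cons a).rTensor (QS K A) t) + (QS.cons a).rTensor (QS K A ⊗[K] QS K A)
          (TensorProduct.assoc K (QS K A) (QS K A) (QS K A) (deconc.rTensor (QS K A) t)) := by
      intro t
      induction t using TensorProduct.induction_on with
      | zero => simp
      | tmul u v =>
        simp only [LinearMap.rTensor_tmul, deconc_cons, TensorProduct.add_tmul, map_add,
          TensorProduct.assoc_tmul]
        congr 1
        generalize deconc u = s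
        induction s using TensorProduct.induction_on with
        | zero => simp
        | tmul y z => simp
        | add s t hs ht => simp only [map_add, TensorProduct.add_tmul, hs, ht]
      | add s t hs ht =>
        simp only [map_add, hs, ht, TensorProduct.tmul_add]
        abel
    have h2 : ∀ t : QS K A ⊗[K] QS K A,
        deconc.lTensor (QS K A) ((QS.cons a).rTensor (QS K A) t) =
        (QS.cons a).rTensor (QS K A ⊗[K] QS K A) (deconc.lTensor (QS K A) t) := by
      intro t
      induction t using TensorProduct.induction_on with
      | zero => simp
      | tmul u v => simp
      | add s t hs ht => simp only [map_add, hs, ht]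
    rw [deconc_cons, map_add, map_add, map_add, h1, hx, h2, LinearMap.rTensor_tmul,
      LinearMap.lTensor_tmul, deconc_one, deconc_cons, TensorProduct.assoc_tmul,
      TensorProduct.tmul_add]
    abel
  | add x y hx hy => simp only [map_add, hx, hy]
  | smul r x hx => simp only [map_smul, hx]

theorem counit_rTensor_deconc (x : QS K A) :
    (QS.augmentation K A).toLinearMap.rTensor (QS K A) (deconc x) = 1 ⊗ₜ[K] x := by
  induction x using QS.induction with
  | one => simp [deconc_one]
  | cons a x hx =>
    have h : (QS.augmentation K A).toLinearMap ∘ₗ QS.cons a = 0 :=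
      LinearMap.ext (QS.augmentation_cons a)
    rw [deconc_cons, map_add, ← LinearMap.rTensor_comp_apply, h]
    simp
  | add x y hx hy => simp only [map_add, hx, hy, TensorProduct.tmul_add]
  | smul r x hx => simp only [map_smul, hx, TensorProduct.tmul_smul]

theorem counit_lTensor_deconc (x : QS K A) :
    (QS.augmentation K A).toLinearMap.lTensor (QS K A) (deconc x) = x ⊗ₜ[K] 1 := by
  induction x using QS.induction with
  | one => simp [deconc_one]
  | cons a x hx =>
    have h : ∀ t : QS K A ⊗[K] QS K A,
        (QS.augmentation K A).toLinearMap.lTensor (QS K A) ((QS.cons a).rTensor (QS K A) t) =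
        (QS.cons a).rTensor K ((QS.augmentation K A).toLinearMap.lTensor (QS K A) t) := by
      intro t
      induction t using TensorProduct.induction_on with
      | zero => simp
      | tmul u v => simp
      | add s t hs ht => simp only [map_add, hs, ht]
    rw [deconc_cons, map_add, h, hx, LinearMap.lTensor_tmul, AlgHom.toLinearMap_apply,
      QS.augmentation_cons]
    simp
  | add x y hx hy => simp only [map_add, hx, hy, TensorProduct.add_tmul]
  | smul r x hx => simp only [map_smul, hx, TensorProduct.smul_tmul']

/-- The quasi-shuffle recursion, carried by the first tensor factor. -/
theorem rTensor_cons_mul_rTensor_cons (a b : A) (s t : QS K A ⊗[K] QS K A) :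
    (QS.cons a).rTensor (QS K A) s * (QS.cons b).rTensor (QS K A) t =
      (QS.cons a).rTensor (QS K A) (s * (QS.cons b).rTensor (QS K A) t) +
      (QS.cons b).rTensor (QS K A) ((QS.cons a).rTensor (QS K A) s * t) +
      (QS.cons (a * b)).rTensor (QS K A) (s * t) := by
  induction s using TensorProduct.induction_on with
  | zero => simp
  | tmul u v =>
    induction t using TensorProduct.induction_on with
    | zero => simp
    | tmul y z =>
      simp only [LinearMap.rTensor_tmul, Algebra.TensorProduct.tmul_mul_tmul, QS.cons_mul_cons,
        TensorProduct.add_tmul]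
    | add s t hs ht =>
      simp only [map_add, mul_add, hs, ht]
      abel
  | add s t hs ht =>
    simp only [map_add, add_mul, hs, ht]
    abel

theorem one_tmul_mul_rTensor_cons (b : A) (x : QS K A) (t : QS K A ⊗[K] QS K A) :
    (1 ⊗ₜ[K] x) * (QS.cons b).rTensor (QS K A) t =
      (QS.cons b).rTensor (QS K A) ((1 ⊗ₜ[K] x) * t) := by
  induction t using TensorProduct.induction_on with
  | zero => simp
  | tmul y z => simp
  | add s t hs ht => simp only [map_add, mul_add, hs, ht]

/-- The deconcatenation coproduct is multiplicative: both sides satisfy the quasi-shuffle recursion.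
-/
theorem deconc_mul (x y : QS K A) : deconc (x * y) = deconc x * deconc y := by
  induction x using QS.induction generalizing y with
  | one => rw [one_mul, deconc_one, ← Algebra.TensorProduct.one_def, one_mul]
  | cons a x hx =>
    induction y using QS.induction with
    | one => rw [mul_one, deconc_one, ← Algebra.TensorProduct.one_def, mul_one]
    | cons b y hy =>
      have h : deconc (QS.cons a x) * deconc (QS.cons b y) =
          1 ⊗ₜ[K] (QS.cons a x * QS.cons b y) +
            (QS.cons b).rTensor (QS K A) ((1 ⊗ₜ[K] QS.cons a x) * deconc y) +
            ((QS.cons a).rTensor (QS K A) (deconc x * (1 ⊗ₜ[K] QS.cons b y)) +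
              (QS.cons a).rTensor (QS K A) (deconc x) *
                (QS.cons b).rTensor (QS K A) (deconc y)) := by
        rw [deconc_cons, deconc_cons, add_mul, mul_add, mul_add, one_tmul_mul_rTensor_cons,
          Algebra.TensorProduct.tmul_mul_tmul, one_mul,
          mul_comm ((QS.cons a).rTensor (QS K A) (deconc x)) (1 ⊗ₜ[K] QS.cons b y),
          one_tmul_mul_rTensor_cons, mul_comm _ (deconc x)]
      rw [h, rTensor_cons_mul_rTensor_cons, QS.cons_mul_cons, map_add, map_add, deconc_cons,
        deconc_cons, deconc_cons, hx, hx, hy, deconc_cons a x, deconc_cons b y]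
      simp only [add_mul, mul_add, map_add, TensorProduct.tmul_add]
      abel
    | add y z hy hz => simp only [map_add, mul_add, hy, hz]
    | smul r y hy => simp only [map_smul, mul_smul_comm, hy]
  | add x z hx hz => simp only [map_add, add_mul, hx, hz]
  | smul r x hx => simp only [map_smul, smul_mul_assoc, hx]

/-- The quasi-shuffle product and the deconcatenation coproduct. -/
instance : Bialgebra K (QS K A) :=
  letI : Coalgebra K (QS K A) :=
    { comul := deconc
      counit := (QS.augmentation K A).toLinearMap
      coassoc := LinearMap.ext deconc_coassoc
      rTensor_counit_comp_comul := LinearMap.ext counit_rTensor_deconc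
      lTensor_counit_comp_comul := LinearMap.ext counit_lTensor_deconc }
  Bialgebra.mk' K (QS K A) (map_one (QS.augmentation K A)) (map_mul (QS.augmentation K A) _ _)
    deconc_one (deconc_mul _ _)

theorem QS.comul_eq (x : QS K A) : Coalgebra.comul (R := K) x = deconc x := rfl

variable (K A) in
/-- The filtration of `QS(A)` by tensor length: `QS.filtration K A n` is spanned by the words of
length at most `n`. -/
def QS.filtration : ℕ → Submodule K (QS K A)
  | 0 => K ∙ 1
  | n + 1 => QS.filtration n ⊔ ⨆ a : A, (QS.filtration n).map (QS.cons a)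

theorem QS.filtration_le_succ (n : ℕ) : QS.filtration K A n ≤ QS.filtration K A (n + 1) :=
  le_sup_left

theorem QS.cons_mem_filtration {n : ℕ} (a : A) {x : QS K A} (hx : x ∈ QS.filtration K A n) :
    QS.cons a x ∈ QS.filtration K A (n + 1) :=
  Submodule.mem_sup_right (Submodule.mem_iSup_of_mem a (Submodule.mem_map_of_mem hx))

theorem QS.word_mem_filtration (l : List A) : QS.word K l ∈ QS.filtration K A l.length := by
  induction l with
  | nil => exact Submodule.mem_span_singleton_self _
  | cons a l ih => exact QS.cons_mem_filtration a ih

theorem QS.filtration_mono : Monotone (QS.filtration K A) :=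
  monotone_nat_of_le_succ QS.filtration_le_succ

theorem QS.exists_mem_filtration (x : QS K A) : ∃ n, x ∈ QS.filtration K A n := by
  induction x using QS.induction with
  | one => exact ⟨0, Submodule.mem_span_singleton_self _⟩
  | cons a x hx =>
    obtain ⟨n, hn⟩ := hx
    exact ⟨n + 1, QS.cons_mem_filtration a hn⟩
  | add x y hx hy =>
    obtain ⟨n, hn⟩ := hx
    obtain ⟨m, hm⟩ := hy
    exact ⟨max n m, add_mem (QS.filtration_mono (le_max_left _ _) hn)
      (QS.filtration_mono (le_max_right _ _) hm)⟩
  | smul r x hx =>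
    obtain ⟨n, hn⟩ := hx
    exact ⟨n, Submodule.smul_mem _ _ hn⟩

theorem QS.tmul_mem_range_mapIncl {p q : Submodule K (QS K A)} {x y : QS K A} (hx : x ∈ p)
    (hy : y ∈ q) : x ⊗ₜ[K] y ∈ LinearMap.range (TensorProduct.mapIncl p q) :=
  ⟨⟨x, hx⟩ ⊗ₜ ⟨y, hy⟩, by simp [TensorProduct.mapIncl]⟩

theorem QS.range_mapIncl_mono {p q p' q' : Submodule K (QS K A)} (hp : p ≤ p') (hq : q ≤ q') :
    LinearMap.range (TensorProduct.mapIncl p q) ≤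
      LinearMap.range (TensorProduct.mapIncl p' q') := by
  rintro _ ⟨t, rfl⟩
  induction t using TensorProduct.induction_on with
  | zero => simp
  | tmul u v => exact QS.tmul_mem_range_mapIncl (hp u.2) (hq v.2)
  | add s t hs ht => simpa only [map_add] using add_mem hs ht

theorem deconc_word (l : List A) :
    deconc (QS.word K l) =
      ∑ i ∈ Finset.range (l.length + 1), QS.word K (l.take i) ⊗ₜ[K] QS.word K (l.drop i) := by
  induction l with
  | nil => simp [QS.word, deconc_one]
  | cons a l ih =>
    rw [QS.word, deconc_cons, ih, List.length_cons, map_sum, add_comm]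
    exact (Finset.sum_range_succ' (fun i => QS.word K ((a :: l).take i) ⊗ₜ[K]
      QS.word K ((a :: l).drop i)) _).symm

/-- The reduced coproduct `Δ x - x ⊗ 1 - 1 ⊗ x`. -/
def redDeconc : QS K A →ₗ[K] QS K A ⊗[K] QS K A :=
  deconc - (TensorProduct.mk K _ _).flip 1 - TensorProduct.mk K _ _ 1

theorem redDeconc_apply (x : QS K A) : redDeconc x = deconc x - x ⊗ₜ[K] 1 - 1 ⊗ₜ[K] x := rfl

/-- In the recursion for `Δ (a ⊗ x)`, the term `1 ⊗ (a ⊗ x)` cancels and the term `x ⊗ 1` of `Δ x`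
provides `(a ⊗ x) ⊗ 1`; the term `1 ⊗ x` of `Δ x` leaves `a ⊗ x`, with `a` in the first factor. -/
theorem redDeconc_cons (a : A) (x : QS K A) : redDeconc (QS.cons a x) =
    (QS.cons a).rTensor (QS K A) (redDeconc x) + QS.cons a 1 ⊗ₜ[K] x := by
  simp only [redDeconc_apply, deconc_cons, map_sub, LinearMap.rTensor_tmul]
  abel

theorem filtration_succ_le_comap_redDeconc (n : ℕ) :
    QS.filtration K A (n + 1) ≤ Submodule.comap redDeconc (LinearMap.range
      (TensorProduct.mapIncl (QS.filtration K A n) (QS.filtration K A n))) := by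
  have h1 : (1 : QS K A) ∈ QS.filtration K A 0 := Submodule.mem_span_singleton_self _
  induction n with
  | zero =>
    refine sup_le (fun x hx => ?_)
      (iSup_le fun a => Submodule.map_le_iff_le_comap.2 fun x hx => ?_)
    · obtain ⟨c, rfl⟩ := Submodule.mem_span_singleton.1 hx
      rw [Submodule.mem_comap, map_smul, redDeconc_apply, deconc_one, sub_self, zero_sub]
      exact Submodule.smul_mem _ _ (neg_mem (QS.tmul_mem_range_mapIncl h1 h1))
    · obtain ⟨c, rfl⟩ := Submodule.mem_span_singleton.1 hx
      -- the tensors of length one are primitive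
      have h : redDeconc (QS.cons a (1 : QS K A)) = 0 := by
        rw [redDeconc_apply, deconc_cons, deconc_one, LinearMap.rTensor_tmul]
        abel
      rw [Submodule.mem_comap, Submodule.mem_comap, map_smul, map_smul, h, smul_zero]
      exact zero_mem _
  | succ n ih =>
    have hn := QS.filtration_le_succ (K := K) (A := A) n
    refine sup_le (fun x hx => QS.range_mapIncl_mono hn hn (ih hx))
      (iSup_le fun a => Submodule.map_le_iff_le_comap.2 fun x hx => ?_)
    rw [Submodule.mem_comap, Submodule.mem_comap, redDeconc_cons]
    refine add_mem ?_ (QS.tmul_mem_range_mapIncl (QS.filtration_mono (Nat.le_add_left 1 n)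
      (QS.cons_mem_filtration a h1)) hx)
    obtain ⟨t, ht⟩ := ih hx
    rw [← ht]
    clear ht
    induction t using TensorProduct.induction_on with
    | zero => simp
    | tmul u v => exact QS.tmul_mem_range_mapIncl (QS.cons_mem_filtration a u.2) (hn v.2)
    | add s t hs ht => simpa only [map_add] using add_mem hs ht

/-- The tensor length makes `QS(A)` a connected filtered bialgebra. -/
theorem isConnectedFiltration :
    ConnectedBialgebra.IsConnectedFiltration (QS.filtration K A) where
  mono := QS.filtration_mono
  exhaustive := QS.exists_mem_filtration
  zero_le := le_rfl
  comul_mem n _ hx := filtration_succ_le_comap_redDeconc n hx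

end Bialgebra

/-! ### Sums over words -/

section WordSum

variable {A R : Type*} [CommRing R] {N : ℕ}

/-- For letter maps `j₁, …, j_N : A → R`, the sum of `F(w) j_{w₁}(a₁) ⋯ j_{wₙ}(aₙ)` over the words
`w` of length `n` in the alphabet `Fin N`. -/
def wordSum (j : Fin N → A → R) : List A → (List (Fin N) → R) → R
  | [], F => F []
  | a :: l, F => ∑ p, j p a * wordSum j l fun w => F (p :: w)

theorem wordSum_congr (j : Fin N → A → R) {l : List A} {F G : List (Fin N) → R}
    (h : ∀ w, w.length = l.length → F w = G w) : wordSum j l F = wordSum j l G := by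
  induction l generalizing F G with
  | nil => exact h [] rfl
  | cons a l ih =>
    exact Finset.sum_congr rfl fun p _ => congrArg _ (ih fun w hw => h _ (by simp [hw]))

theorem wordSum_zero (j : Fin N → A → R) (l : List A) : wordSum j l (fun _ => 0) = 0 := by
  induction l with
  | nil => rfl
  | cons a l ih => simp [wordSum, ih]

theorem wordSum_mul_left (j : Fin N → A → R) (l : List A) (F : List (Fin N) → R) (r : R) :
    wordSum j l (fun w => r * F w) = r * wordSum j l F := by
  induction l generalizing F with
  | nil => rfl
  | cons a l ih =>
    simp only [wordSum, ih, Finset.mul_sum]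
    exact Finset.sum_congr rfl fun p _ => by ring

theorem wordSum_sum {ι : Type*} (j : Fin N → A → R) (l : List A) (s : Finset ι)
    (F : ι → List (Fin N) → R) :
    wordSum j l (fun w => ∑ i ∈ s, F i w) = ∑ i ∈ s, wordSum j l (F i) := by
  induction l generalizing F with
  | nil => rfl
  | cons a l ih =>
    simp only [wordSum, ih, Finset.mul_sum]
    exact Finset.sum_comm

theorem wordSum_take_mul_drop (j : Fin N → A → R) (l : List A) (i : ℕ)
    (F G : List (Fin N) → R) :
    wordSum j l (fun w => F (w.take i) * G (w.drop i)) =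
      wordSum j (l.take i) F * wordSum j (l.drop i) G := by
  induction l generalizing i F with
  | nil => simp [wordSum]
  | cons a l ih =>
    cases i with
    | zero =>
      have h := wordSum_mul_left j (a :: l) G (F [])
      simpa [wordSum] using h
    | succ i =>
      simp only [wordSum, List.take_succ_cons, List.drop_succ_cons, Finset.sum_mul]
      refine Finset.sum_congr rfl fun p _ => ?_
      rw [ih i (fun w => F (p :: w)), mul_assoc]

theorem wordSum_ofFn (j : Fin N → A → R) {n : ℕ} (a : Fin n → A) (F : List (Fin N) → R) :
    wordSum j (List.ofFn a) F =
      ∑ w : Fin n → Fin N, (∏ t, j (w t) (a t)) * F (List.ofFn w) := by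
  induction n generalizing F with
  | zero => simp [wordSum]
  | succ n ih =>
    rw [← (Fin.consEquiv fun _ => Fin N).sum_comp, Fintype.sum_prod_type, List.ofFn_succ, wordSum]
    refine Finset.sum_congr rfl fun p _ => ?_
    rw [ih, Finset.mul_sum]
    refine Finset.sum_congr rfl fun w _ => ?_
    rw [← mul_assoc]
    congr 1
    · simp [Fin.prod_univ_succ, Fin.consEquiv]
    · simp [List.ofFn_succ, Fin.consEquiv]

end WordSum

/-! ### Evaluation of tensors by sums over increasing words -/

section Eval

variable {K A R : Type*} [Field K] [NonUnitalCommRing A] [Module K A] [IsScalarTower K A A]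
  [SMulCommClass K A A] [CommRing R] [Algebra K R] {N : ℕ}

/-- One step of the recursion defining `evalFrom`. -/
def evalStep (j : Fin N → A →ₙₐ[K] R) : A →ₗ[K] Module.End K (ℕ → R) :=
  LinearMap.mk₂ K (fun a G m => ∑ p : Fin N, if m ≤ p then j p a * G (p + 1) else 0)
    (fun a b G => by
      funext m
      simp only [Pi.add_apply, ← Finset.sum_add_distrib]
      exact Finset.sum_congr rfl fun p _ => by split_ifs <;> simp [add_mul])
    (fun r a G => by
      funext m
      simp only [Pi.smul_apply, Finset.smul_sum]
      exact Finset.sum_congr rfl fun p _ => by split_ifs <;> simp)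
    (fun a G G' => by
      funext m
      simp only [Pi.add_apply, ← Finset.sum_add_distrib]
      exact Finset.sum_congr rfl fun p _ => by split_ifs <;> simp [mul_add])
    (fun r a G => by
      funext m
      simp only [Pi.smul_apply, Finset.smul_sum]
      exact Finset.sum_congr rfl fun p _ => by split_ifs <;> simp)

/-- The linear map sending `a₁ ⊗ ⋯ ⊗ aₙ` to the sum of `j_{i₁}(a₁) ⋯ j_{iₙ}(aₙ)` over
`m ≤ i₁ < ⋯ < iₙ < N`, as in the definition of quasi-symmetric functions. -/
def evalFrom (j : Fin N → A →ₙₐ[K] R) (m : ℕ) : QS K A →ₗ[K] R :=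
  LinearMap.proj m ∘ₗ
    (LinearMap.applyₗ (fun _ => 1) : Module.End K (ℕ → R) →ₗ[K] ℕ → R) ∘ₗ
      (TensorAlgebra.lift K (evalStep j)).toLinearMap ∘ₗ (QS.ofTensor K A).symm.toLinearMap

theorem evalFrom_one (j : Fin N → A →ₙₐ[K] R) (m : ℕ) : evalFrom j m (1 : QS K A) = 1 := by
  simp [evalFrom, QS.symm_one]

theorem evalFrom_cons (j : Fin N → A →ₙₐ[K] R) (m : ℕ) (a : A) (x : QS K A) :
    evalFrom j m (QS.cons a x) =
      ∑ p : Fin N, if m ≤ p then j p a * evalFrom j (p + 1) x else 0 := by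
  have h : (QS.ofTensor K A).symm (QS.cons a x) =
    TensorAlgebra.ι K a * (QS.ofTensor K A).symm x := rfl
  simp only [evalFrom, LinearMap.comp_apply, LinearEquiv.coe_coe, AlgHom.toLinearMap_apply,
    LinearMap.applyₗ_apply_apply, h, map_mul, TensorAlgebra.lift_ι_apply, Module.End.mul_apply]
  rfl

theorem evalFrom_cons_of_le (j : Fin N → A →ₙₐ[K] R) {m : ℕ} (hm : N ≤ m) (a : A) (x : QS K A) :
    evalFrom j m (QS.cons a x) = 0 := by
  rw [evalFrom_cons]
  refine Finset.sum_eq_zero fun p _ => if_neg ?_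
  have := p.2
  omega

theorem evalFrom_cons_of_lt (j : Fin N → A →ₙₐ[K] R) {m : ℕ} (hm : m < N) (a : A) (x : QS K A) :
    evalFrom j m (QS.cons a x) =
      j ⟨m, hm⟩ a * evalFrom j (m + 1) x + evalFrom j (m + 1) (QS.cons a x) := by
  rw [evalFrom_cons, evalFrom_cons, ← Fintype.sum_ite_eq' ⟨m, hm⟩
    (fun p : Fin N => j p a * evalFrom j (p + 1) x), ← Finset.sum_add_distrib]
  refine Finset.sum_congr rfl fun p _ => ?_
  rcases lt_trichotomy m p with h | h | h
  · rw [if_pos h.le, if_neg (fun hp => by simp [hp] at h), if_pos (Nat.succ_le_of_lt h), zero_add]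
  · rw [if_pos h.le, if_pos (Fin.ext h.symm), if_neg (by omega), add_zero]
  · rw [if_neg (by omega), if_neg (fun hp => by simp [hp] at h), if_neg (by omega), add_zero]

/-- Evaluation is multiplicative for the quasi-shuffle product: this is the discrete product rule,
by descending induction on the lower bound `m` of the indices. -/
theorem evalFrom_mul (j : Fin N → A →ₙₐ[K] R) (m : ℕ) (x y : QS K A) :
    evalFrom j m (x * y) = evalFrom j m x * evalFrom j m y := by
  induction x using QS.induction generalizing m y with
  | one => rw [one_mul, evalFrom_one, one_mul]
  | cons a x hx =>
    induction y using QS.induction generalizing m with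
    | one => rw [mul_one, evalFrom_one, mul_one]
    | cons b y hy =>
      obtain ⟨d, hd⟩ : ∃ d, N ≤ m + d := ⟨N, by omega⟩
      induction d generalizing m with
      | zero =>
        have hd : N ≤ m := hd
        rw [QS.cons_mul_cons]
        simp only [map_add, evalFrom_cons_of_le j hd, add_zero, mul_zero]
      | succ d ih =>
        rcases lt_or_ge m N with hm | hm
        · have h := ih (m + 1) (by omega)
          rw [QS.cons_mul_cons] at h ⊢
          simp only [map_add] at h
          simp only [map_add, evalFrom_cons_of_lt j hm, hx, hy, map_mul]
          linear_combination h
        · exact ih m (by omega)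
    | add y z hy hz => simp only [map_add, mul_add, hy, hz]
    | smul r y hy => simp only [map_smul, mul_smul_comm, hy]
  | add x z hx hz => simp only [map_add, add_mul, hx, hz]
  | smul r x hx => simp only [map_smul, smul_mul_assoc, hx]

open scoped Classical in
theorem evalFrom_word (j : Fin N → A →ₙₐ[K] R) (m : ℕ) (l : List A) :
    evalFrom j m (QS.word K l) = wordSum (fun p => j p) l
      fun w => if w.Pairwise (· < ·) ∧ ∀ p ∈ w, m ≤ (p : ℕ) then 1 else 0 := by
  induction l generalizing m with
  | nil => simp [QS.word, wordSum, evalFrom_one]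
  | cons a l ih =>
    rw [QS.word, evalFrom_cons, wordSum]
    refine Finset.sum_congr rfl fun p _ => ?_
    split_ifs with hp
    · rw [ih]
      refine congrArg _ (wordSum_congr _ fun w _ => ?_)
      refine if_congr ?_ rfl rfl
      rw [List.pairwise_cons, List.forall_mem_cons]
      constructor
      · rintro ⟨h1, h2⟩
        exact ⟨⟨fun q hq => h2 q hq, h1⟩, hp, fun q hq => by have := h2 q hq; omega⟩
      · rintro ⟨⟨h1, h2⟩, -, -⟩
        exact ⟨h2, fun q hq => h1 q hq⟩
    · rw [wordSum_congr _ (G := fun _ => 0), wordSum_zero, mul_zero]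
      intro w _
      rw [if_neg]
      rintro ⟨-, h⟩
      exact hp (h p (by simp))

/-- The morphism of algebras `QS(A) → R` sending `a₁ ⊗ ⋯ ⊗ aₙ` to the sum of
`j_{i₁}(a₁) ⋯ j_{iₙ}(aₙ)` over `i₁ < ⋯ < iₙ`. -/
def evalHom (j : Fin N → A →ₙₐ[K] R) : QS K A →ₐ[K] R :=
  AlgHom.ofLinearMap (evalFrom j 0) (evalFrom_one j 0) (evalFrom_mul j 0)

open scoped Classical in
theorem evalHom_word (j : Fin N → A →ₙₐ[K] R) (l : List A) :
    evalHom j (QS.word K l) =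
      wordSum (fun p => j p) l fun w => if w.Pairwise (· < ·) then 1 else 0 := by
  have h := evalFrom_word j 0 l
  simp only [Nat.zero_le, implies_true, and_true] at h
  exact h

open scoped Classical in
theorem evalHom_word_ofFn (j : Fin N → A →ₙₐ[K] R) {n : ℕ} (c : Fin n → A) :
    evalHom j (QS.word K (List.ofFn c)) =
      ∑ i : Fin n → Fin N with StrictMono i, ∏ t, j (i t) (c t) := by
  rw [evalHom_word, wordSum_ofFn, Finset.sum_filter]
  refine Finset.sum_congr rfl fun i _ => ?_
  rw [mul_ite, mul_one, mul_zero]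
  refine if_congr ?_ rfl rfl
  rw [List.pairwise_ofFn]
  rfl

end Eval

/-! ### Evaluations separate the elements of `QS(A)` -/

section Separation

variable {K A : Type*} [Field K] [NonUnitalCommRing A] [Module K A] [IsScalarTower K A A]
  [SMulCommClass K A A]

variable (K A) in
/-- The insertion of `A` at the place `p` of the `N`-th tensor power of its unitization. -/
def slot (N : ℕ) (p : Fin N) : A →ₙₐ[K] ⨂[K] _ : Fin N, Unitization K A :=
  (PiTensorProduct.singleAlgHom (R := K) (A := fun _ : Fin N => Unitization K A) p
    : Unitization K A →ₙₐ[K] _).comp (Unitization.inrNonUnitalAlgHom K A)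

variable (K A) in
/-- The projection of the `N`-th tensor power of the unitization of `A` onto `A^{⊗ N}`. -/
def projPower (N : ℕ) : (⨂[K] _ : Fin N, Unitization K A) →ₗ[K] QS K A :=
  (QS.ofTensor K A).toLinearMap ∘ₗ PiTensorProduct.lift
    ((TensorAlgebra.tprod K A N).compLinearMap fun _ => Unitization.sndHom K K A)

theorem projPower_prod_slot {N n : ℕ} (i : Fin n → Fin N) (c : Fin n → A) :
    projPower K A N (∏ t, slot K A N (i t) (c t)) =
      QS.word K (List.ofFn fun p => (∏ t, (if i t = p then Unitization.inr (c t) else 1 :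
        Unitization K A)).snd) := by
  have h : ∏ t, slot K A N (i t) (c t) = PiTensorProduct.tprod K
      (∏ t, fun p => (if i t = p then Unitization.inr (c t) else 1 : Unitization K A)) := by
    rw [PiTensorProduct.tprod_prod]
    refine Finset.prod_congr rfl fun t _ => congrArg (PiTensorProduct.tprod K) (funext fun p => ?_)
    simp [Pi.mulSingle_apply, eq_comm]
  rw [h, projPower, LinearMap.comp_apply, PiTensorProduct.lift.tprod, ← QS.ofTensor_tprod]
  simp [Finset.prod_apply]

theorem projPower_evalHom_word (N : ℕ) (l : List A) :
    projPower K A N (evalHom (slot K A N) (QS.word K l)) =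
      if l.length = N then QS.word K l else 0 := by
  classical
  obtain ⟨n, c, rfl⟩ : ∃ n, ∃ c : Fin n → A, l = List.ofFn c := ⟨_, _, (List.ofFn_get l).symm⟩
  rw [evalHom_word_ofFn, map_sum, List.length_ofFn]
  simp only [projPower_prod_slot]
  split_ifs with h
  · subst h
    rw [Finset.sum_eq_single id]
    · simp
    · intro i hi hne
      have hi : StrictMono i := (Finset.mem_filter.1 hi).2
      refine absurd (hi.range_inj strictMono_id |>.1 ?_) hne
      rw [(Finite.injective_iff_surjective.1 hi.injective).range_eq, Set.range_id]
    · exact fun h => absurd (Finset.mem_filter.2 ⟨Finset.mem_univ _, strictMono_id⟩) h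
  · refine Finset.sum_eq_zero fun i hi => ?_
    have hi : StrictMono i := (Finset.mem_filter.1 hi).2
    -- some place is not hit by `i`, so the corresponding factor is the unit, whose component in
    -- `A` vanishes
    have hs : ¬ Function.Surjective i := fun hs => h (by
      simpa using Fintype.card_of_bijective ⟨hi.injective, hs⟩)
    simp only [Function.Surjective, not_forall, not_exists] at hs
    obtain ⟨p, hp⟩ := hs
    rw [← QS.ofTensor_tprod]
    refine (congrArg _ (MultilinearMap.map_coord_zero _ p ?_)).trans (map_zero _)
    simp [hp]

/-- The evaluations of `QS(A)` in the tensor powers of the unitization of `A` are jointly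
injective. -/
theorem eq_of_evalHom_slot_eq {x y : QS K A}
    (h : ∀ N, evalHom (slot K A N) x = evalHom (slot K A N) y) : x = y := by
  have key : ∀ z : QS K A, ∃ M, ∀ N, M ≤ N →
      ∑ k ∈ Finset.range N, projPower K A k (evalHom (slot K A k) z) = z := by
    intro z
    induction z using QS.word_induction with
    | word l =>
      refine ⟨l.length + 1, fun N hN => ?_⟩
      simp only [projPower_evalHom_word, Finset.sum_ite_eq, Finset.mem_range]
      exact if_pos hN
    | add x y hx hy =>
      obtain ⟨M, hM⟩ := hx
      obtain ⟨M', hM'⟩ := hy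
      refine ⟨max M M', fun N hN => ?_⟩
      simp only [map_add, Finset.sum_add_distrib]
      rw [hM N (by omega), hM' N (by omega)]
    | smul r x hx =>
      obtain ⟨M, hM⟩ := hx
      refine ⟨M, fun N hN => ?_⟩
      simp only [map_smul, ← Finset.smul_sum]
      rw [hM N hN]
  obtain ⟨M, hM⟩ := key x
  obtain ⟨M', hM'⟩ := key y
  rw [← hM (max M M') (le_max_left _ _), ← hM' (max M M') (le_max_right _ _)]
  simp only [h]

end Separation

/-! ### The letters of packed words -/

theorem pack_getElem_lt_iff (w : List ℕ) {s t : ℕ} (hs : s < w.length) (ht : t < w.length) :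
    (pack w)[s]'(by simpa using hs) < (pack w)[t]'(by simpa using ht) ↔ w[s] < w[t] := by
  simp only [pack, List.getElem_map]
  constructor
  · intro h
    by_contra! hc
    refine absurd h (not_lt.2 (Finset.card_le_card fun z hz => ?_))
    rw [Finset.mem_filter] at hz ⊢
    exact ⟨hz.1, hz.2.trans hc⟩
  · exact rank_lt_rank w _ _ (List.getElem_mem _)

theorem pairwise_lt_iff_of_pack_eq {w v : List ℕ} (h : pack w = pack v) :
    w.Pairwise (· < ·) ↔ v.Pairwise (· < ·) := by
  have hl : w.length = v.length := by
    rw [← length_pack w, h, length_pack]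
  simp only [List.pairwise_iff_getElem]
  constructor
  · intro H s t hs ht hst
    rw [← pack_getElem_lt_iff v hs ht]
    simp only [← h]
    exact (pack_getElem_lt_iff w _ _).2 (H s t (by omega) (by omega) hst)
  · intro H s t hs ht hst
    rw [← pack_getElem_lt_iff w hs ht]
    simp only [h]
    exact (pack_getElem_lt_iff v _ _).2 (H s t (by omega) (by omega) hst)

theorem ofList_eq_identity_iff (w : List ℕ) :
    PackedWord.ofList w = PackedWord.identity w.length ↔ w.Pairwise (· < ·) := by
  have hr : (List.range' 1 w.length).Pairwise (· < ·) := by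
    simpa using List.pairwise_lt_range' (s := 1) (n := w.length) (step := 1)
  constructor
  · intro h
    exact (pairwise_lt_iff_of_pack_eq (congrArg Subtype.val h)).2 hr
  · intro h
    -- `w` is the image of `12⋯n` under the increasing map `x ↦ w[x - 1]`
    have h1 : w = (List.range' 1 w.length).map fun x => w.getD (x - 1) 0 := by
      refine List.ext_getElem (by simp) fun t h1 h2 => ?_
      simp [h1]
    refine Subtype.ext ?_
    refine (congrArg pack h1).trans (pack_map_of_lt _ _ fun x hx y hy hxy => ?_)
    rw [List.mem_range'_1] at hx hy
    have hx' : x - 1 < w.length := by omega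
    have hy' : y - 1 < w.length := by omega
    rw [List.getD_eq_getElem _ _ hx', List.getD_eq_getElem _ _ hy']
    exact List.pairwise_iff_getElem.1 h _ _ hx' hy' (by omega)

/-- The letters of a packed word are `1, …, k`, where `k` is the largest one. -/
theorem PackedWord.toFinset_eq_Icc (u : PackedWord) : u.1.toFinset = Finset.Icc 1 u.max := by
  have hrank : ∀ x ∈ u.1, (u.1.toFinset.filter (fun y => y ≤ x)).card = x := by
    have h : u.1.map (fun x => (u.1.toFinset.filter (fun y => y ≤ x)).card) = u.1.map id := by
      rw [List.map_id]
      exact u.2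
    exact List.map_inj_left.1 h
  refine Finset.eq_of_subset_of_card_le (fun x hx => ?_) ?_
  · rw [Finset.mem_Icc]
    have hx' := List.mem_toFinset.1 hx
    refine ⟨?_, Finset.le_sup (f := id) hx⟩
    rw [← hrank x hx']
    exact Finset.card_pos.2 ⟨x, by simp [hx']⟩
  · rw [Nat.card_Icc, Nat.add_sub_cancel]
    rcases u.1.toFinset.eq_empty_or_nonempty with h | h
    · simp [PackedWord.max, h]
    · obtain ⟨x, hx, hmax⟩ := Finset.exists_mem_eq_sup _ h id
      have hmax : u.max = x := hmax
      rw [hmax]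
      conv_lhs => rw [← hrank x (List.mem_toFinset.1 hx)]
      exact Finset.card_le_card (Finset.filter_subset _ _)

/-- The letter of `u` at the position `t`, as an index of a block (blocks are counted from `0`). -/
def PackedWord.blockIdx (u : PackedWord) {n : ℕ} (h : u.length = n) (t : Fin n) : Fin u.max :=
  ⟨u.letter h t - 1, by have := u.one_le_letter h t; have := u.letter_le_max h t; omega⟩

theorem PackedWord.letter_eq_iff (u : PackedWord) {n : ℕ} (h : u.length = n) (t : Fin n)
    (l : Fin u.max) : u.letter h t = l + 1 ↔ u.blockIdx h t = l := by
  have := u.one_le_letter h t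
  rw [Fin.ext_iff]
  simp only [PackedWord.blockIdx]
  omega

theorem PackedWord.blockIdx_surjective (u : PackedWord) {n : ℕ} (h : u.length = n) :
    Function.Surjective (u.blockIdx h) := by
  intro l
  have hl : (l : ℕ) + 1 ∈ u.1.toFinset := by
    rw [u.toFinset_eq_Icc, Finset.mem_Icc]
    omega
  obtain ⟨t, ht, hl⟩ := List.mem_iff_getElem.1 (List.mem_toFinset.1 hl)
  exact ⟨⟨t, h ▸ ht⟩, (u.letter_eq_iff h _ l).1 hl⟩

theorem PackedWord.ofList_strictMono_comp {N n : ℕ} (u : PackedWord) (h : u.length = n)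
    {i : Fin u.max → Fin N} (hi : StrictMono i) :
    PackedWord.ofList ((List.ofFn (i ∘ u.blockIdx h)).map Fin.val) = u := by
  let g : ℕ → ℕ := fun x => if hx : x - 1 < u.max then i ⟨x - 1, hx⟩ else 0
  have h1 : (List.ofFn (i ∘ u.blockIdx h)).map Fin.val = u.1.map g := by
    refine List.ext_getElem ?_ fun t h1 h2 => ?_
    · have h' : u.1.length = n := h
      simpa using h'.symm
    · have ht : t < n := by simpa using h1
      have h3 := (u.blockIdx h ⟨t, ht⟩).2
      simp only [PackedWord.blockIdx, PackedWord.letter] at h3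
      simp [g, PackedWord.blockIdx, PackedWord.letter, h3]
  refine Subtype.ext ?_
  refine (congrArg pack h1).trans ((pack_map_of_lt _ _ fun x hx y hy hxy => ?_).trans u.2)
  have hx' := List.mem_toFinset.2 hx
  have hy' := List.mem_toFinset.2 hy
  rw [u.toFinset_eq_Icc, Finset.mem_Icc] at hx' hy'
  have hx1 : x - 1 < u.max := by omega
  have hy1 : y - 1 < u.max := by omega
  simp only [g, dif_pos hx1, dif_pos hy1]
  exact hi (show x - 1 < y - 1 by omega)

theorem PackedWord.blockIdx_lt_iff {N n : ℕ} (u : PackedWord) (h : u.length = n)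
    {w : Fin n → Fin N} (hw : PackedWord.ofList ((List.ofFn w).map Fin.val) = u) (s t : Fin n) :
    u.blockIdx h s < u.blockIdx h t ↔ w s < w t := by
  have h1 := u.one_le_letter h s
  have h2 := u.one_le_letter h t
  have h3 : u.blockIdx h s < u.blockIdx h t ↔ u.letter h s < u.letter h t := by
    rw [Fin.lt_def]
    simp only [PackedWord.blockIdx]
    omega
  rw [h3]
  subst hw
  have h4 := pack_getElem_lt_iff ((List.ofFn w).map Fin.val) (s := s) (t := t) (by simp) (by simp)
  exact h4.trans (by simp)

/-! ### The action of `WQSym` on evaluations -/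

section Action

variable {K A R : Type*} [Field K] [NonUnitalCommRing A] [Module K A] [IsScalarTower K A A]
  [SMulCommClass K A A] [CommRing R] [Algebra K R] {N : ℕ}

theorem map_blockProd (j : A →ₙₐ[K] R) {n : ℕ} (u : PackedWord) (h : u.length = n)
    (a : Fin n → A) (l : Fin u.max) :
    j (blockProd (K := K) u h a (l + 1)) =
      ∏ t : Fin n with u.blockIdx h t = l, j (a t) := by
  classical
  have h1 : Finset.univ.filter (fun t : Fin n => u.letter h t = l + 1) =
      Finset.univ.filter (fun t : Fin n => u.blockIdx h t = l) :=
    Finset.filter_congr fun t _ => u.letter_eq_iff h t l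
  set z : Unitization K A := ∏ t : Fin n with u.blockIdx h t = l, Unitization.inr (a t) with hz
  have h2 : blockProd (K := K) u h a (l + 1) = z.snd := by
    rw [hz, ← h1, blockProd]
  have h3 : z.fst = 0 := by
    obtain ⟨t, ht⟩ := u.blockIdx_surjective h l
    have h4 : Unitization.fstHom K A z = 0 := by
      rw [hz, map_prod]
      exact Finset.prod_eq_zero (Finset.mem_filter.2 ⟨Finset.mem_univ t, ht⟩) rfl
    exact h4
  have h5 : Unitization.lift j z = j z.snd := by
    conv_lhs => rw [← Unitization.inl_fst_add_inr_snd_eq z, h3]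
    simp
  rw [h2, ← h5, hz, map_prod]
  simp

/-- Increasing words in the blocks of a packed word `u` correspond to the words with packing `u`. -/
theorem sum_strictMono_eq_sum_pack (j : Fin N → A →ₙₐ[K] R) {n : ℕ} (u : PackedWord)
    (h : u.length = n) (a : Fin n → A) [DecidablePred (StrictMono (α := Fin u.max) (β := Fin N))]
    [DecidableEq PackedWord] :
    ∑ i : Fin u.max → Fin N with StrictMono i, ∏ l, j (i l) (blockProd (K := K) u h a (l + 1)) =
      ∑ w : Fin n → Fin N with PackedWord.ofList ((List.ofFn w).map Fin.val) = u,
        ∏ t, j (w t) (a t) := by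
  refine Finset.sum_bij (fun i _ => i ∘ u.blockIdx h) ?_ ?_ ?_ ?_
  · intro i hi
    exact Finset.mem_filter.2 ⟨Finset.mem_univ _,
      u.ofList_strictMono_comp h (Finset.mem_filter.1 hi).2⟩
  · intro i _ i' _ hii
    exact (u.blockIdx_surjective h).injective_comp_right hii
  · intro w hw
    have hlt := u.blockIdx_lt_iff h (Finset.mem_filter.1 hw).2
    choose t ht using u.blockIdx_surjective h
    refine ⟨w ∘ t, Finset.mem_filter.2 ⟨Finset.mem_univ _, fun l l' hl => ?_⟩, funext fun s => ?_⟩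
    · rw [Function.comp_apply, Function.comp_apply, ← hlt, ht, ht]
      exact hl
    · have hs := ht (u.blockIdx h s)
      have h1 := hlt (t (u.blockIdx h s)) s
      have h2 := hlt s (t (u.blockIdx h s))
      rw [hs] at h1 h2
      exact le_antisymm (not_lt.1 (mt h2.2 (lt_irrefl _))) (not_lt.1 (mt h1.2 (lt_irrefl _)))
  · intro i _
    rw [← Finset.prod_fiberwise Finset.univ (u.blockIdx h)]
    refine Finset.prod_congr rfl fun l _ => ?_
    rw [map_blockProd]
    refine Finset.prod_congr rfl fun t ht => ?_
    rw [Function.comp_apply, (Finset.mem_filter.1 ht).2]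

/-- The evaluation of `(a₁ ⊗ ⋯ ⊗ aₙ) · f` is a sum over all words, weighted by the coefficients of
`f` at their packings. -/
theorem evalHom_act_word (j : Fin N → A →ₙₐ[K] R) (f : WQSymHat K) (l : List A) :
    evalHom j (act f (QS.word K l)) = wordSum (fun p => j p) l fun w =>
      algebraMap K R (f (PackedWord.ofList (w.map Fin.val))) := by
  classical
  obtain ⟨n, a, rfl⟩ : ∃ n, ∃ a : Fin n → A, l = List.ofFn a := ⟨_, _, (List.ofFn_get l).symm⟩
  rw [wordSum_ofFn, ← QS.ofTensor_tprod, act_tprod, map_sum]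
  simp only [QS.ofTensor_tprod, map_smul]
  have h1 : ∀ u : {u : PackedWord // u.length = n},
      f u.1 • evalHom j (QS.word K (List.ofFn fun i : Fin u.1.max =>
        blockProd (K := K) u.1 u.2 a (i + 1))) =
      ∑ w : Fin n → Fin N, if PackedWord.ofList ((List.ofFn w).map Fin.val) = u.1 then
        (∏ t, j (w t) (a t)) * algebraMap K R (f u.1) else 0 := by
    intro u
    rw [evalHom_word_ofFn, sum_strictMono_eq_sum_pack, Finset.smul_sum, Finset.sum_filter]
    refine Finset.sum_congr rfl fun w _ => ?_
    rw [Algebra.smul_def, mul_comm]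
  rw [Finset.sum_congr rfl fun u _ => h1 u, Finset.sum_comm]
  refine Finset.sum_congr rfl fun w _ => ?_
  have hw : (PackedWord.ofList ((List.ofFn w).map Fin.val)).length = n := by
    simp [PackedWord.length, PackedWord.ofList]
  rw [Fintype.sum_eq_single ⟨_, hw⟩, if_pos rfl]
  intro u hu
  rw [if_neg]
  exact fun h => hu (Subtype.ext h.symm)

end Action

/-! ### The action as a morphism to the convolution algebra -/

section Convolution

variable {K A : Type*} [Field K] [NonUnitalCommRing A] [Module K A] [IsScalarTower K A A]
  [SMulCommClass K A A]

open WithConv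

theorem QS.hom_ext {M : Type*} [AddCommGroup M] [Module K M] {f g : QS K A →ₗ[K] M}
    (h : ∀ l, f (QS.word K l) = g (QS.word K l)) : f = g := by
  ext x
  induction x using QS.word_induction with
  | word l => exact h l
  | add x y hx hy => rw [map_add, map_add, hx, hy]
  | smul r x hx => rw [map_smul, map_smul, hx]

theorem conv_apply_word {R : Type*} [CommRing R] [Algebra K R]
    (φ ψ : WithConv (QS K A →ₗ[K] R)) (l : List A) :
    (φ * ψ) (QS.word K l) = ∑ i ∈ Finset.range (l.length + 1),
      φ (QS.word K (l.take i)) * ψ (QS.word K (l.drop i)) := by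
  rw [LinearMap.convMul_apply, QS.comul_eq, deconc_word, map_sum, map_sum]
  rfl

/-- The outer product of word quasi-symmetric functions acts as the convolution product: after any
evaluation, both sides become the sum over all words and all their splittings. -/
theorem act_mul (f g : WQSymHat K) :
    toConv (act (A := A) (f * g)) = toConv (act f) * toConv (act g) := by
  refine WithConv.ext (QS.hom_ext fun l => eq_of_evalHom_slot_eq fun N => ?_)
  rw [conv_apply_word, map_sum]
  change evalHom _ (act (f * g) (QS.word K l)) = _
  rw [evalHom_act_word]
  have h1 : ∀ w : List (Fin N), w.length = l.length →
      algebraMap K (⨂[K] _ : Fin N, Unitization K A)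
        ((f * g) (PackedWord.ofList (w.map Fin.val))) =
      ∑ i ∈ Finset.range (l.length + 1),
        algebraMap K (⨂[K] _ : Fin N, Unitization K A)
          (f (PackedWord.ofList ((w.take i).map Fin.val))) *
        algebraMap K (⨂[K] _ : Fin N, Unitization K A)
          (g (PackedWord.ofList ((w.drop i).map Fin.val))) := by
    intro w hw
    have hl : (PackedWord.ofList (w.map Fin.val)).length = l.length := by
      simp [PackedWord.length, PackedWord.ofList, hw]
    rw [WQSymHat.mul_apply, map_sum, hl]
    refine Finset.sum_congr rfl fun i _ => ?_
    rw [map_mul]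
    congr 3
    · refine Subtype.ext ?_
      simp only [PackedWord.ofList, pack_take_pack, List.map_take]
    · refine Subtype.ext ?_
      simp only [PackedWord.ofList, pack_drop_pack, List.map_drop]
  rw [wordSum_congr _ h1, wordSum_sum]
  refine Finset.sum_congr rfl fun i _ => ?_
  rw [map_mul, wordSum_take_mul_drop (fun p => slot K A N p) l i
    (fun w => algebraMap K _ (f (PackedWord.ofList (w.map Fin.val))))
    (fun w => algebraMap K _ (g (PackedWord.ofList (w.map Fin.val))))]
  rw [← evalHom_act_word, ← evalHom_act_word]

theorem act_one : toConv (act (A := A) (1 : WQSymHat K)) = 1 := by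
  classical
  refine WithConv.ext (QS.hom_ext fun l => eq_of_evalHom_slot_eq fun N => ?_)
  change evalHom _ (act 1 (QS.word K l)) = evalHom _ (algebraMap K _ (QS.augmentation K A _))
  rw [evalHom_act_word, AlgHom.commutes]
  simp only [WQSymHat.one_apply, WQSymHat.ofList_eq_nil_iff, List.map_eq_nil_iff]
  cases l with
  | nil => simp [wordSum, QS.word]
  | cons a l => simp [wordSum, wordSum_zero, QS.word, QS.augmentation_cons]

theorem act_I : act (A := A) (WQSymHat.I K) = LinearMap.id := by
  classical
  refine QS.hom_ext fun l => eq_of_evalHom_slot_eq fun N => ?_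
  rw [evalHom_act_word, LinearMap.id_apply, evalHom_word]
  refine wordSum_congr _ fun w _ => ?_
  have h : WQSymHat.I K (PackedWord.ofList (w.map Fin.val)) =
      if w.Pairwise (· < ·) then 1 else 0 := by
    have hl : (PackedWord.ofList (w.map Fin.val)).length = (w.map Fin.val).length := by
      simp [PackedWord.length, PackedWord.ofList]
    rw [WQSymHat.I, hl]
    refine if_congr ?_ rfl rfl
    rw [ofList_eq_identity_iff, List.pairwise_map]
    rfl
  rw [h]
  split_ifs <;> simp

theorem act_sub (f g : WQSymHat K) : act (A := A) (f - g) = act f - act g := by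
  refine QS.hom_ext fun l => ?_
  obtain ⟨n, a, rfl⟩ : ∃ n, ∃ a : Fin n → A, l = List.ofFn a := ⟨_, _, (List.ofFn_get l).symm⟩
  have h : ∀ u : PackedWord, (f - g) u = f u - g u := fun u => by
    rw [sub_eq_add_neg, sub_eq_add_neg]
    rfl
  rw [← QS.ofTensor_tprod, LinearMap.sub_apply, act_tprod, act_tprod, act_tprod,
    ← Finset.sum_sub_distrib]
  simp only [h, sub_smul]

theorem act_I_sub_one_pow (k : ℕ) :
    toConv (act (A := A) ((WQSymHat.I K - 1) ^ k)) =
      ConnectedBialgebra.idSubOne K (QS K A) ^ k := by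
  induction k with
  | zero => rw [pow_zero, pow_zero, act_one]
  | succ k ih =>
    rw [pow_succ, pow_succ, act_mul, ih, act_sub, toConv_sub, act_one, act_I]
    rfl

/-- The quasi-Eulerian idempotent acts as the logarithm of the identity. -/
theorem eulerian_eq_logId [CharZero K] :
    eulerian K A = ConnectedBialgebra.logId isConnectedFiltration := by
  refine QS.hom_ext fun l => ?_
  rw [ConnectedBialgebra.logId_eq_sum_range _ (N := l.length + 1) fun k hk =>
    isConnectedFiltration.conv_pow_apply_eq_zero ConnectedBialgebra.idSubOne_apply_one
      (QS.word_mem_filtration l) hk]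
  -- the term of index `0` has the coefficient `-1 / 0 = 0`
  rw [Finset.sum_range_succ', Nat.cast_zero, div_zero, zero_smul, add_zero]
  simp only [← act_I_sub_one_pow]
  obtain ⟨n, a, rfl⟩ : ∃ n, ∃ a : Fin n → A, l = List.ofFn a := ⟨_, _, (List.ofFn_get l).symm⟩
  simp only [eulerian, ← QS.ofTensor_tprod, act_tprod, Finset.smul_sum, List.length_ofFn]
  rw [Finset.sum_comm]
  refine Finset.sum_congr rfl fun u _ => ?_
  have h : WQSymHat.e₁ K u.1 = ∑ k ∈ Finset.range n,
      ((-1) ^ (k + 1 + 1) / ((k + 1 : ℕ) : K)) * ((WQSymHat.I K - 1) ^ (k + 1)) u.1 := by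
    rw [Finset.range_eq_Ico, Finset.sum_Ico_add' (fun k : ℕ => ((-1) ^ (k + 1) / (k : K)) *
      ((WQSymHat.I K - 1) ^ k) u.1) 0 n 1]
    rw [WQSymHat.e₁, WQSymHat.log, u.2]
    rfl
  rw [h, Finset.sum_smul]
  simp only [mul_smul]

end Convolution

/-! ### Naturality of the action -/

section Naturality

variable {K A B : Type*} [Field K] [NonUnitalCommRing A] [Module K A] [IsScalarTower K A A]
  [SMulCommClass K A A] [NonUnitalCommRing B] [Module K B] [IsScalarTower K B B]
  [SMulCommClass K B B]

theorem QS.map_word (g : A →ₙₐ[K] B) (l : List A) :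
    QS.map g (QS.word K l) = QS.word K (l.map g) := by
  induction l with
  | nil => simp [QS.map, QS.word, QS.symm_one, QS.ofTensor_one]
  | cons a l ih =>
    rw [List.map_cons, QS.word, QS.word, ← ih]
    have h : (QS.ofTensor K A).symm (QS.cons a (QS.word K l)) =
      TensorAlgebra.ι K a * (QS.ofTensor K A).symm (QS.word K l) := rfl
    simp only [QS.map, LinearMap.comp_apply, LinearEquiv.coe_coe, AlgHom.toLinearMap_apply, h,
      map_mul, TensorAlgebra.lift_ι_apply]
    rfl

theorem blockProd_map (g : A →ₙₐ[K] B) {n : ℕ} (u : PackedWord) (h : u.length = n)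
    (a : Fin n → A) (i : ℕ) :
    g (blockProd (K := K) u h a i) = blockProd (K := K) u h (g ∘ a) i := by
  have h1 : ∀ z : Unitization K A,
      g z.snd = (Unitization.lift ((Unitization.inrNonUnitalAlgHom K B).comp g) z).snd := by
    intro z
    simp [Unitization.algebraMap_eq_inl]
  unfold blockProd
  rw [h1, map_prod]
  simp

theorem QS.map_act (g : A →ₙₐ[K] B) (f : WQSymHat K) (x : QS K A) :
    QS.map g (act f x) = act f (QS.map g x) := by
  suffices h : QS.map g ∘ₗ act f = act f ∘ₗ QS.map g from LinearMap.congr_fun h x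
  refine QS.hom_ext fun l => ?_
  obtain ⟨n, a, rfl⟩ : ∃ n, ∃ a : Fin n → A, l = List.ofFn a := ⟨_, _, (List.ofFn_get l).symm⟩
  rw [LinearMap.comp_apply, LinearMap.comp_apply, QS.map_word, List.map_ofFn,
    ← QS.ofTensor_tprod, ← QS.ofTensor_tprod, act_tprod, act_tprod, map_sum]
  refine Finset.sum_congr rfl fun u _ => ?_
  rw [map_smul, QS.ofTensor_tprod, QS.ofTensor_tprod, QS.map_word, List.map_ofFn]
  congr 3
  funext i
  exact blockProd_map g u.1 u.2 a (i + 1)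

end Naturality

end QuasiShuffle

end

open QuasiShuffle in
theorem mainTheorem1 {K : Type*} [Field K] [CharZero K] {A : Type*} [NonUnitalCommRing A]
    [Module K A] [IsScalarTower K A A] [SMulCommClass K A A] :
    -- `e₁` acts as a projection, with image contained in `QS(A)⁺`
    eulerian K A ∘ₗ eulerian K A = eulerian K A ∧
    LinearMap.range (eulerian K A) ≤ QS.plus K A ∧
    -- its kernel contains `(QS(A)⁺)²`
    QS.plusSq K A ≤ LinearMap.ker (eulerian K A) ∧
    -- it induces a well-defined endomorphism of `QS(A)⁺ / (QS(A)⁺)²`, which is the identity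
    (∃ (h₁ : ∀ x ∈ QS.plus K A, eulerian K A x ∈ QS.plus K A)
      (h₂ : QS.decomposables K A ≤
        (QS.decomposables K A).comap ((eulerian K A).restrict h₁)),
      (QS.decomposables K A).mapQ (QS.decomposables K A) ((eulerian K A).restrict h₁) h₂ =
        LinearMap.id) ∧
    -- its image is a complement of `(QS(A)⁺)²` in `QS(A)⁺`
    Disjoint (LinearMap.range (eulerian K A)) (QS.plusSq K A) ∧
    LinearMap.range (eulerian K A) ⊔ QS.plusSq K A = QS.plus K A ∧
    -- the image is isomorphic to the indecomposables: the map induced by `e₁` is inverse to the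
    -- projection
    (∃ θ : QS.Indecomposables K A ≃ₗ[K] LinearMap.range (eulerian K A),
      (∀ x : QS.plus K A, (θ (Submodule.Quotient.mk x) : QS K A) = eulerian K A x) ∧
      ∀ (v : LinearMap.range (eulerian K A)) (hv : (v : QS K A) ∈ QS.plus K A),
        θ.symm v = Submodule.Quotient.mk ⟨v, hv⟩) ∧
    -- all this is natural in `A`
    (∀ (B : Type*) [NonUnitalCommRing B] [Module K B] [IsScalarTower K B B] [SMulCommClass K B B]
      (g : A →ₙₐ[K] B) (x : QS K A),
      QS.map g (eulerian K A x) = eulerian K B (QS.map g x)) ∧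
    -- `QS(A)` is the free commutative algebra on the image
    IsSymmetricAlgebra (LinearMap.range (eulerian K A)).subtype := by
  have he : eulerian K A = ConnectedBialgebra.logId isConnectedFiltration := eulerian_eq_logId
  have hmem : ∀ x, eulerian K A x ∈ QS.plus K A := fun x => by
    rw [he]
    exact ConnectedBialgebra.logId_mem isConnectedFiltration x
  have hsq : ∀ x ∈ QS.plusSq K A, eulerian K A x = 0 := fun x hx => by
    rw [he]
    exact ConnectedBialgebra.logId_eq_zero_of_mem_sq isConnectedFiltration hx
  have hsub : ∀ x ∈ QS.plus K A, eulerian K A x - x ∈ QS.plusSq K A := fun x hx => by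
    rw [he]
    exact ConnectedBialgebra.logId_sub_mem isConnectedFiltration hx
  have hproj : ∀ x ∈ QS.plus K A, eulerian K A (eulerian K A x) = eulerian K A x := fun x hx => by
    have h := hsq _ (hsub x hx)
    rwa [map_sub, sub_eq_zero] at h
  have hone : eulerian K A 1 = 0 := by
    rw [he]
    exact ConnectedBialgebra.logId_one isConnectedFiltration
  have hidem : ∀ x, eulerian K A (eulerian K A x) = eulerian K A x := fun x => by
    -- split off the scalar component of `x`, which `e₁` kills
    have hx : x - QS.augmentation K A x • 1 ∈ QS.plus K A := by
      change QS.augmentation K A _ = 0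
      simp
    have h := hproj _ hx
    rwa [map_sub, map_smul, hone, smul_zero, sub_zero] at h
  have hle : LinearMap.range (eulerian K A) ≤ QS.plus K A := by
    rintro _ ⟨x, rfl⟩
    exact hmem x
  have hsq_le : QS.plusSq K A ≤ QS.plus K A := fun x hx => Ideal.pow_le_self two_ne_zero hx
  refine ⟨LinearMap.ext hidem, hle, hsq, ⟨fun x _ => hmem x, fun x hx => ?_, ?_⟩,
    ?_, ?_, ?_, ?_, ?_⟩
  · have h : eulerian K A x = 0 := hsq x hx
    change eulerian K A x ∈ QS.plusSq K A
    rw [h]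
    exact zero_mem _
  · refine Submodule.linearMap_qext _ (LinearMap.ext fun x => ?_)
    exact (Submodule.Quotient.eq _).2 (hsub x x.2)
  · rw [Submodule.disjoint_def]
    rintro _ ⟨x, rfl⟩ hx
    rw [← hidem]
    exact hsq _ hx
  · refine le_antisymm (sup_le hle hsq_le) fun x hx => ?_
    rw [← sub_sub_cancel (eulerian K A x) x]
    exact sub_mem (Submodule.mem_sup_left ⟨x, rfl⟩) (Submodule.mem_sup_right (hsub x hx))
  · let f : QS.Indecomposables K A →ₗ[K] LinearMap.range (eulerian K A) :=
      (QS.decomposables K A).liftQ ((eulerian K A).rangeRestrict ∘ₗ (QS.plus K A).subtype)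
        fun x hx => Subtype.ext (hsq x hx)
    let p : LinearMap.range (eulerian K A) →ₗ[K] QS.Indecomposables K A :=
      (QS.decomposables K A).mkQ ∘ₗ Submodule.inclusion hle
    refine ⟨LinearEquiv.ofLinearMap f p (LinearMap.ext ?_) ?_, fun x => rfl, fun v hv => rfl⟩
    · rintro ⟨_, x, rfl⟩
      exact Subtype.ext (hidem x)
    · refine Submodule.linearMap_qext _ (LinearMap.ext fun x => ?_)
      exact (Submodule.Quotient.eq _).2 (hsub x x.2)
  · intro B _ _ _ _ g x
    exact QS.map_act g _ x
  · rw [he]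
    exact ConnectedBialgebra.isSymmetricAlgebra_range_logId isConnectedFiltration
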